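/- Let $d\ge 1$ and let $\Omega\subset\mathbb{R}^d$ be a bounded open set satisfying the cone condition, i.e. there is a finite cone $C$ (given by a height $\rho>0$ and an aperture angle $0<\kappa\le\pi$) such that every $x\in\Omega$ is the vertex of a finite cone contained in $\Omega$ and congruent to $C$. Let $L:\Omega\times\mathbb{R}^N\times\mathbb{R}^{N\times d}\to\mathbb{R}\cup\{+\infty\}$ be a Carathéodory function: $(u,\xi)\mapsto L(x,u,\xi)$ is continuous (with values in the extended reals) for almost every $x\in\Omega$, and $x\mapsto L(x,u,\xi)$ is measurable for every $(u,\xi)$. Assume that for some $a>0$ and $c\in L^1(\Omega)$ $$L(x,u,\xi)\ge a|\xi|+c(x)\qquad\text{for a.e. }x\in\Omega\text{ and all }(u,\xi)\in\mathbb{R}^N\times\mathbb{R}^{N\times d}.$$ Let $$J(u)=\int_\Omega L\bigl(x,u(x),\nabla u(x)\bigr)\,dx\in\mathbb{R}\cup\{+\infty\},\qquad u\in W^{1,1}(\Omega;\mathbb{R}^N),$$ and suppose that $J(u_0)$ is finite for some $u_0\in W^{1,1}(\Omega;\mathbb{R}^N)$. Let $W^{1,1}_0(\Omega;\mathbb{R}^N)$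 be the closure of $C_c^\infty(\Omega;\mathbb{R}^N)$ in $W^{1,1}(\Omega;\mathbb{R}^N)$. A minimizing sequence is a sequence $(u_n)$ in $u_0+W^{1,1}_0(\Omega;\mathbb{R}^N)$ with $J(u_n)\to\inf_{u_0+W_0^{1,1}}J$, and a minimizer is a $\bar u\in u_0+W_0^{1,1}(\Omega;\mathbb{R}^N)$ with $J(\bar u)=\inf_{u_0+W_0^{1,1}}J$. Then: 1. Every minimizing sequence is bounded in $W^{1,1}(\Omega;\mathbb{R}^N)$. 2. Suppose that for almost every $x\in\Omega$ and every $u\in\mathbb{R}^N$ the function $\xi\mapsto L(x,u,\xi)$ is convex, and that there is a minimizing sequence $(u_n)$ whose first-order derivatives are equi-integrable: there is a function $\delta:(0,\infty)\to(0,\infty)$ such that $\sum_{i=1}^d\int_A|\partial_i u_n|\,dx<\varepsilon$ for all $n$, all $\varepsilon>0$ and all measurable $A\subset\Omega$ with Lebesgue measure less than $\delta(\varepsilon)$. Then $J$ has a minimizer. 3. If for almost every $x\in\Omega$ the function $(u,\xi)\mapsto L(x,u,\xi)$ is strictly convex (that is, the convexity inequality holds, and it is strict at any two distinct points where $L(x,\cdot,\cdot)$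 is finite), then there is at most one minimizer. -/

import Mathlib

open MeasureTheory Filter Topology Set
open scoped ContDiff ENNReal

noncomputable section

namespace SobolevMin

/-- `ℝⁿ` with the Euclidean norm. -/
abbrev Vec (n : ℕ) : Type := EuclideanSpace ℝ (Fin n)

/-- `ℝ^{N × d}` with the Euclidean (Frobenius) norm. -/
abbrev Mat (N d : ℕ) : Type := EuclideanSpace ℝ (Fin N × Fin d)

/-- The Lebesgue space `L¹(Ω; ℝ^N)`. -/
abbrev LOne {d : ℕ} (Ω : Set (Vec d)) (N : ℕ) : Type :=
  Lp (Vec N) 1 (volume.restrict Ω)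

/-- The finite cone with vertex at the origin, axis direction `v`, height `ρ` and aperture
angle `κ`: the origin together with all `y ≠ 0` with `|y| ≤ ρ` that make an angle at most `κ / 2`
with `v`. -/
def finiteCone {d : ℕ} (v : Vec d) (ρ κ : ℝ) : Set (Vec d) :=
  {y | y = 0 ∨ (0 < ‖y‖ ∧ ‖y‖ ≤ ρ ∧ InnerProductGeometry.angle y v ≤ κ / 2)}

/-- The cone condition: every point of `Ω` is the vertex of a finite cone contained in `Ω` and
congruent to one fixed finite cone (two finite cones are congruent as soon as they have the same
height and the same aperture angle; the axis direction may depend on the point). -/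
def ConeCondition {d : ℕ} (Ω : Set (Vec d)) : Prop :=
  ∃ ρ κ : ℝ, 0 < ρ ∧ 0 < κ ∧ κ ≤ Real.pi ∧
    ∀ x ∈ Ω, ∃ v : Vec d, v ≠ 0 ∧ ∀ y ∈ finiteCone v ρ κ, x + y ∈ Ω

/-- `φ ∈ C_c^∞(Ω; F)`. -/
structure IsTestFunction {d : ℕ} (Ω : Set (Vec d)) {F : Type*} [NormedAddCommGroup F]
    [NormedSpace ℝ F] (φ : Vec d → F) : Prop where
  smooth : ContDiff ℝ ∞ φ
  compact : HasCompactSupport φ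
  support : tsupport φ ⊆ Ω

/-- The classical `i`-th partial derivative of `φ`. -/
def pderiv {d : ℕ} {F : Type*} [NormedAddCommGroup F] [NormedSpace ℝ F]
    (i : Fin d) (φ : Vec d → F) (x : Vec d) : F :=
  fderiv ℝ φ x (EuclideanSpace.single i 1)

/-- `g` is the weak `i`-th partial derivative of `u` in `Ω`. -/
def IsWeakPartial {d N : ℕ} (Ω : Set (Vec d)) (i : Fin d) (u g : Vec d → Vec N) : Prop :=
  ∀ φ : Vec d → ℝ, IsTestFunction Ω φ →
    ∫ x in Ω, pderiv i φ x • u x = - ∫ x in Ω, φ x • g x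

theorem IsTestFunction.continuous_pderiv {d : ℕ} {Ω : Set (Vec d)} {F : Type*}
    [NormedAddCommGroup F] [NormedSpace ℝ F] {φ : Vec d → F} (h : IsTestFunction Ω φ)
    (i : Fin d) : Continuous (pderiv i φ) :=
  (h.smooth.continuous_fderiv (by simp)).clm_apply continuous_const

theorem IsTestFunction.integrable_smul {d N : ℕ} {Ω : Set (Vec d)} {φ : Vec d → ℝ}
    (h : IsTestFunction Ω φ) {u : Vec d → Vec N} (hu : Integrable u (volume.restrict Ω)) :
    Integrable (fun x => φ x • u x) (volume.restrict Ω) := by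
  obtain ⟨C, hC⟩ := h.compact.exists_bound_of_continuous h.smooth.continuous
  exact hu.bdd_smul C h.smooth.continuous.aestronglyMeasurable (Eventually.of_forall hC)

theorem IsTestFunction.integrable_pderiv_smul {d N : ℕ} {Ω : Set (Vec d)} {φ : Vec d → ℝ}
    (h : IsTestFunction Ω φ) (i : Fin d) {u : Vec d → Vec N}
    (hu : Integrable u (volume.restrict Ω)) :
    Integrable (fun x => pderiv i φ x • u x) (volume.restrict Ω) := by
  have hs : HasCompactSupport (pderiv i φ) := h.compact.fderiv_apply ℝ _
  obtain ⟨C, hC⟩ := hs.exists_bound_of_continuous (h.continuous_pderiv i)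
  exact hu.bdd_smul C (h.continuous_pderiv i).aestronglyMeasurable (Eventually.of_forall hC)

/-- The Sobolev space `W^{1,1}(Ω; ℝ^N)`. An element is a function `u ∈ L¹(Ω; ℝ^N)` together with
its weak partial derivatives `∂₁u, …, ∂_d u ∈ L¹(Ω; ℝ^N)`; for open `Ω` the latter are determined
by `u`, see `eq_of_fn_eq`. -/
def W11 {d : ℕ} (Ω : Set (Vec d)) (N : ℕ) : Submodule ℝ (LOne Ω N × (Fin d → LOne Ω N)) where
  carrier := {p | ∀ i, IsWeakPartial Ω i p.1 (p.2 i)}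
  zero_mem' := by
    intro i φ hφ
    have h0 : ∀ᵐ x ∂(volume.restrict Ω), (0 : LOne Ω N) x = 0 :=
      Lp.coeFn_zero (Vec N) 1 (volume.restrict Ω)
    have h1 : ∫ x in Ω, pderiv i φ x • (0 : LOne Ω N) x = 0 := by
      apply integral_eq_zero_of_ae
      filter_upwards [h0] with x hx
      rw [hx, smul_zero]; rfl
    have h2 : ∫ x in Ω, φ x • (0 : LOne Ω N) x = 0 := by
      apply integral_eq_zero_of_ae
      filter_upwards [h0] with x hx
      rw [hx, smul_zero]; rfl
    exact h1.trans (by rw [← neg_zero]; exact congrArg Neg.neg h2.symm)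
  add_mem' := by
    intro p q hp hq i φ hφ
    have h1 : ∫ x in Ω, pderiv i φ x • (p.1 + q.1 : LOne Ω N) x
        = ∫ x in Ω, (pderiv i φ x • p.1 x + pderiv i φ x • q.1 x) := by
      apply integral_congr_ae
      filter_upwards [Lp.coeFn_add p.1 q.1] with x hx
      rw [hx, Pi.add_apply, smul_add]
    have h2 : ∫ x in Ω, φ x • (p.2 i + q.2 i : LOne Ω N) x
        = ∫ x in Ω, (φ x • p.2 i x + φ x • q.2 i x) := by
      apply integral_congr_ae
      filter_upwards [Lp.coeFn_add (p.2 i) (q.2 i)] with x hx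
      rw [hx, Pi.add_apply, smul_add]
    rw [integral_add (hφ.integrable_pderiv_smul i (L1.integrable_coeFn _))
      (hφ.integrable_pderiv_smul i (L1.integrable_coeFn _))] at h1
    rw [integral_add (hφ.integrable_smul (L1.integrable_coeFn _))
      (hφ.integrable_smul (L1.integrable_coeFn _))] at h2
    refine h1.trans ?_
    rw [hp i φ hφ, hq i φ hφ, ← neg_add]
    exact congrArg Neg.neg h2.symm
  smul_mem' := by
    intro r p hp i φ hφ
    have h1 : ∫ x in Ω, pderiv i φ x • (r • p.1 : LOne Ω N) x
        = ∫ x in Ω, r • (pderiv i φ x • p.1 x) := by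
      apply integral_congr_ae
      filter_upwards [Lp.coeFn_smul r p.1] with x hx
      rw [hx, Pi.smul_apply, smul_comm]
    have h2 : ∫ x in Ω, φ x • (r • p.2 i : LOne Ω N) x
        = ∫ x in Ω, r • (φ x • p.2 i x) := by
      apply integral_congr_ae
      filter_upwards [Lp.coeFn_smul r (p.2 i)] with x hx
      rw [hx, Pi.smul_apply, smul_comm]
    rw [integral_smul] at h1 h2
    refine h1.trans ?_
    rw [hp i φ hφ, smul_neg]
    exact congrArg Neg.neg h2.symm

section

variable {d N : ℕ} {Ω : Set (Vec d)}

/-- The underlying `L¹` function. -/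
def fn (u : W11 Ω N) : LOne Ω N := u.1.1

/-- The weak partial derivative `∂ᵢu`. -/
def weakD (u : W11 Ω N) (i : Fin d) : LOne Ω N := u.1.2 i

/-- The weak gradient `∇u(x)`, the `N × d` matrix with entries `∂ᵢuʲ(x)`. -/
def grad (u : W11 Ω N) (x : Vec d) : Mat N d :=
  WithLp.toLp 2 fun p : Fin N × Fin d => weakD u p.2 x p.1

/-- The norm `‖u‖_{L¹} + ∑ᵢ ‖∂ᵢu‖_{L¹}` of `W^{1,1}(Ω; ℝ^N)`. -/
def sobolevNorm (u : W11 Ω N) : ℝ := ‖fn u‖ + ∑ i, ‖weakD u i‖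

/-- An element of `W^{1,1}` is determined by its underlying `L¹` function. -/
theorem eq_of_fn_eq (hΩ : IsOpen Ω) {u v : W11 Ω N} (h : fn u = fn v) : u = v := by
  apply Subtype.ext
  refine Prod.ext h ?_
  funext i
  have hint : Integrable (fun x => u.1.2 i x - v.1.2 i x) (volume.restrict Ω) :=
    (L1.integrable_coeFn _).sub (L1.integrable_coeFn _)
  have key : ∀ᵐ x ∂(volume : Measure (Vec d)), x ∈ Ω → u.1.2 i x - v.1.2 i x = 0 := by
    refine hΩ.ae_eq_zero_of_integral_contDiff_smul_eq_zero
      (IntegrableOn.locallyIntegrableOn hint) ?_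
    intro g hg hc hs
    have hφ : IsTestFunction Ω g := ⟨hg, hc, hs⟩
    have h0 : ∫ x, g x • (u.1.2 i x - v.1.2 i x)
        = ∫ x in Ω, g x • (u.1.2 i x - v.1.2 i x) := by
      symm
      apply setIntegral_eq_integral_of_forall_compl_eq_zero
      intro x hx
      have : g x = 0 := by
        by_contra hne
        exact hx (hs (subset_tsupport g hne))
      rw [this, zero_smul]
    rw [h0]
    simp only [smul_sub]
    rw [integral_sub (hφ.integrable_smul (L1.integrable_coeFn _))
      (hφ.integrable_smul (L1.integrable_coeFn _))]
    have hu := u.2 i g hφ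
    have hv := v.2 i g hφ
    have h' : u.1.1 = v.1.1 := h
    rw [h', hv] at hu
    rw [neg_inj.mp hu, sub_self]
  apply Lp.ext
  rw [EventuallyEq, ae_restrict_iff' hΩ.measurableSet]
  filter_upwards [key] with x hx hxΩ
  exact sub_eq_zero.mp (hx hxΩ)

/-- Membership in `W_0^{1,1}(Ω; ℝ^N)`, the closure of `C_c^∞(Ω; ℝ^N)` in the norm of
`W^{1,1}(Ω; ℝ^N)`. -/
def IsZeroBoundary (v : W11 Ω N) : Prop :=
  ∀ ε > 0, ∃ φ : Vec d → Vec N, IsTestFunction Ω φ ∧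
    (∫ x in Ω, ‖fn v x - φ x‖) + ∑ i, ∫ x in Ω, ‖weakD v i x - pderiv i φ x‖ < ε

/-- The affine class `u₀ + W_0^{1,1}(Ω; ℝ^N)`. -/
def affineClass (u₀ : W11 Ω N) : Set (W11 Ω N) := {u | IsZeroBoundary (u - u₀)}

/-- The first-order derivatives of the functions `u 0, u 1, …` are equi-integrable. -/
def TopOrderEquiIntegrable (u : ℕ → W11 Ω N) : Prop :=
  ∃ δ : ℝ → ℝ, (∀ ε > 0, 0 < δ ε) ∧
    ∀ n, ∀ ε > 0, ∀ A ⊆ Ω, MeasurableSet A → volume A < ENNReal.ofReal (δ ε) →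
      ∑ i, ∫ x in A, ‖weakD (u n) i x‖ < ε

end

/-- The integral `∫ f⁺ - ∫ f⁻` of an extended-real-valued function. -/
def extIntegral {X : Type*} [MeasurableSpace X] (μ : Measure X) (f : X → EReal) : EReal :=
  ((∫⁻ x, (f x).toENNReal ∂μ : ℝ≥0∞) : EReal) - ((∫⁻ x, (-f x).toENNReal ∂μ : ℝ≥0∞) : EReal)

/-- Carathéodory functions `L : Ω × ℝ^N × ℝ^{N × d} → ℝ ∪ {+∞}`: never `-∞`, continuous in
`(u, ξ)` (for the topology of the extended reals) for almost every `x`, and Lebesgue measurable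
in `x` for every `(u, ξ)`. -/
structure IsCaratheodory {d N : ℕ} (Ω : Set (Vec d)) (L : Vec d → Vec N → Mat N d → EReal) :
    Prop where
  ne_bot : ∀ x ∈ Ω, ∀ u ξ, L x u ξ ≠ ⊥
  cont : ∀ᵐ x ∂(volume.restrict Ω), Continuous fun p : Vec N × Mat N d => L x p.1 p.2
  meas : ∀ u ξ, AEMeasurable (fun x => L x u ξ) (volume.restrict Ω)

/-- The functional `J(u) = ∫_Ω L(x, u(x), ∇u(x)) dx`. -/
def energy {d N : ℕ} {Ω : Set (Vec d)} (L : Vec d → Vec N → Mat N d → EReal) (u : W11 Ω N) :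
    EReal :=
  extIntegral (volume.restrict Ω) fun x => L x (fn u x) (grad u x)

/-- `u` is a minimizing sequence of `J` in the class `𝒜`. -/
def IsMinimizingSeq {X : Type*} (J : X → EReal) (𝒜 : Set X) (u : ℕ → X) : Prop :=
  (∀ n, u n ∈ 𝒜) ∧ Tendsto (fun n => J (u n)) atTop (𝓝 (⨅ v ∈ 𝒜, J v))

/-- `u` is a minimizer of `J` in the class `𝒜`. -/
def IsMinimizer {X : Type*} (J : X → EReal) (𝒜 : Set X) (u : X) : Prop :=
  u ∈ 𝒜 ∧ ∀ v ∈ 𝒜, J u ≤ J v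

/-- Convexity of a function with values in `ℝ ∪ {+∞}`. -/
def ExtConvex {V : Type*} [AddCommGroup V] [Module ℝ V] (f : V → EReal) : Prop :=
  ∀ p q : V, ∀ t : ℝ, 0 < t → t < 1 →
    f (t • p + (1 - t) • q) ≤ (t : EReal) * f p + ((1 - t : ℝ) : EReal) * f q

/-- Strict convexity of a function with values in `ℝ ∪ {+∞}`: the convexity inequality is strict
at any two distinct points where the function is finite (at other pairs of points its right-hand
side is `+∞`). -/
def ExtStrictConvex {V : Type*} [AddCommGroup V] [Module ℝ V] (f : V → EReal) : Prop :=
  ∀ p q : V, p ≠ q → f p ≠ ⊤ → f q ≠ ⊤ → ∀ t : ℝ, 0 < t → t < 1 →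
    f (t • p + (1 - t) • q) < (t : EReal) * f p + ((1 - t : ℝ) : EReal) * f q

end SobolevMin

end

open SobolevMin

/-! Bounds. The lower bound on `L` controls the `L¹` norm of the gradient by the energy. On
`W_0^{1,1}` Poincaré's inequality (`exists_poincare`) then controls the function itself: a
translation by the diameter of a ball containing Ω moves a test function off its own support.
Rellich's theorem (`exists_subseq_tendsto_of_bounded`) is obtained for test functions, extended by
zero, from mollification and Arzelà–Ascoli, and then by density.

Existence. Along a subsequence the functions `u_n` converge in `L¹` and almost everywhere to some
`f`. The densities `h_n = L(x, u_n, ∇u_n)` are only bounded in `L¹`, so weak compactness is not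
available for them. It is replaced by a Komlós-type selection
(`exists_ae_tendsto_of_antitone_convex`): in the convex hulls of the tails of `(∇u_n, h_n)` one
picks near-minimizers of `∫ √(1 + |y|²)`. The infima over the tails increase to a finite limit and
midpoints cannot beat them, so strict convexity makes the selection Cauchy in measure, and a
subsequence converges almost everywhere. Equi-integrability survives convex combinations, hence by
Vitali the selected gradients converge in `L¹`; the limit is a function `U` in the affine class with
`U = f`. Fatou's lemma, with the integrable minorant `c`, bounds the integral of the limit density
`η` by the infimum. For fixed `x`, the point `(∇U, η)` is a limit of convex combinations of points
in the epigraphs of `L(x, u_m(x), ·)`, where `u_m(x) → f(x)`. Coercivity gives these epigraphs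
Cesari's property (Q) (`le_of_tendsto_convexHull`), so `L(x, U, ∇U) ≤ η`, and integration gives
minimality.

Uniqueness. The midpoint of two minimizers would have strictly smaller energy unless the functions
and gradients agree almost everywhere. -/

namespace SobolevMin

/-! ### Extended-real integrals and measurability of Carathéodory compositions -/

section ExtIntegral

variable {X : Type*} [MeasurableSpace X] {μ : Measure X}

theorem extIntegral_mono {f g : X → EReal} (h : f ≤ᵐ[μ] g) :
    extIntegral μ f ≤ extIntegral μ g := by
  refine EReal.sub_le_sub ?_ ?_
  · refine EReal.coe_ennreal_le_coe_ennreal_iff.2 (lintegral_mono_ae ?_)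
    filter_upwards [h] with x hx using EReal.toENNReal_le_toENNReal hx
  · refine EReal.coe_ennreal_le_coe_ennreal_iff.2 (lintegral_mono_ae ?_)
    filter_upwards [h] with x hx using EReal.toENNReal_le_toENNReal (EReal.neg_le_neg_iff.2 hx)

theorem extIntegral_congr {f g : X → EReal} (h : f =ᵐ[μ] g) :
    extIntegral μ f = extIntegral μ g :=
  le_antisymm (extIntegral_mono h.le) (extIntegral_mono h.symm.le)

theorem extIntegral_coe {f : X → ℝ} (hf : Integrable f μ) :
    extIntegral μ (fun x => (f x : EReal)) = ((∫ x, f x ∂μ : ℝ) : EReal) := by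
  have h1 : ∫⁻ x, ENNReal.ofReal (f x) ∂μ ≠ ⊤ := hf.lintegral_lt_top.ne
  have h2 : ∫⁻ x, ENNReal.ofReal (-f x) ∂μ ≠ ⊤ := hf.neg.lintegral_lt_top.ne
  rw [integral_eq_lintegral_pos_part_sub_lintegral_neg_part hf, EReal.coe_sub,
    EReal.coe_ennreal_toReal h1, EReal.coe_ennreal_toReal h2]
  unfold extIntegral
  simp only [← EReal.coe_neg, EReal.real_coe_toENNReal]

/-- A measurable function bounded below by an integrable one and with integral `< ⊤` is almost
everywhere equal to a real integrable function. -/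
theorem exists_integrable_of_extIntegral_lt_top {f : X → EReal} (hm : AEMeasurable f μ)
    {c : X → ℝ} (hc : Integrable c μ) (hcf : ∀ᵐ x ∂μ, (c x : EReal) ≤ f x)
    (hf : extIntegral μ f < ⊤) :
    ∃ h : X → ℝ, Integrable h μ ∧ f =ᵐ[μ] fun x => (h x : EReal) := by
  have hneg : ∫⁻ x, (-f x).toENNReal ∂μ ≠ ⊤ := by
    refine ne_top_of_le_ne_top hc.neg.lintegral_lt_top.ne (lintegral_mono_ae ?_)
    filter_upwards [hcf] with x hx
    rw [Pi.neg_apply, ← EReal.real_coe_toENNReal]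
    exact EReal.toENNReal_le_toENNReal (by simpa using EReal.neg_le_neg_iff.2 hx)
  -- The negative part has finite integral, so an infinite positive part would make the difference
  -- `⊤`.
  have hpos : ∫⁻ x, (f x).toENNReal ∂μ ≠ ⊤ := by
    intro htop
    refine hf.ne ?_
    unfold extIntegral
    rw [htop, ← EReal.coe_ennreal_toReal hneg, EReal.coe_ennreal_top, EReal.top_sub_coe]
  have hlt : ∀ᵐ x ∂μ, f x ≠ ⊤ := by
    filter_upwards [ae_lt_top' hm.ereal_toENNReal hpos] with x hx h
    simp [h] at hx
  have heq : f =ᵐ[μ] fun x => ((f x).toReal : EReal) := by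
    filter_upwards [hlt, hcf] with x h1 h2
    rw [EReal.coe_toReal h1 (fun hb => by simp [hb] at h2)]
  refine ⟨fun x => (f x).toReal, ⟨hm.ereal_toReal.aestronglyMeasurable, ?_⟩, heq⟩
  have hle : ∫⁻ x, ‖(f x).toReal‖ₑ ∂μ ≤ ∫⁻ x, ((f x).toENNReal + (-f x).toENNReal) ∂μ := by
    refine lintegral_mono_ae ?_
    filter_upwards [heq] with x hx
    rw [hx]
    simp only [EReal.toReal_coe, ← EReal.coe_neg, EReal.real_coe_toENNReal]
    rw [← ofReal_norm, Real.norm_eq_abs]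
    rcases le_total 0 (f x).toReal with h | h
    · rw [abs_of_nonneg h]; exact le_self_add
    · rw [abs_of_nonpos h]; exact le_add_self
  refine lt_of_le_of_lt hle ?_
  rw [lintegral_add_left' hm.ereal_toENNReal]
  exact ENNReal.add_lt_top.2 ⟨hpos.lt_top, hneg.lt_top⟩

/-- A Carathéodory function composed with a measurable function is measurable. -/
theorem aemeasurable_comp_of_continuous {E Y : Type*} [TopologicalSpace E]
    [TopologicalSpace Y] [PolishSpace Y] [MeasurableSpace Y] [BorelSpace Y]
    {f : X → E → Y} (hcont : ∀ᵐ x ∂μ, Continuous (f x))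
    (hmeas : ∀ p, AEMeasurable (fun x => f x p) μ) {g : X → E} (hg : AEStronglyMeasurable g μ) :
    AEMeasurable (fun x => f x (g x)) μ := by
  obtain ⟨g', hg', hgg'⟩ := hg
  have hs : ∀ s : SimpleFunc X E, AEMeasurable (fun x => f x (s x)) μ := by
    intro s
    -- On each of the finitely many fibres of a simple function the second argument is frozen, so
    -- `hmeas` applies; continuity then passes to limits of simple functions.
    have hU : (⋃ p : s.range, s ⁻¹' {(p : E)}) = univ := by
      ext x; simp
    rw [← Measure.restrict_univ (μ := μ), ← hU, aemeasurable_iUnion_iff]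
    intro p
    refine ((hmeas p).restrict).congr ?_
    filter_upwards [ae_restrict_mem (s.measurableSet_fiber p)] with x hx
    rw [show s x = p from hx]
  refine aemeasurable_of_tendsto_metrizable_ae' (fun n => hs (hg'.approx n)) ?_
  filter_upwards [hcont, hgg'] with x hx hxg
  rw [hxg]
  exact (hx.tendsto _).comp (hg'.tendsto_approx x)

end ExtIntegral

/-! ### Measurability of the energy density -/

section Energy

variable {d N : ℕ} {Ω : Set (Vec d)}

theorem grad_apply (u : W11 Ω N) (x : Vec d) (p : Fin N × Fin d) :
    grad u x p = weakD u p.2 x p.1 := rfl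

theorem aestronglyMeasurable_grad (u : W11 Ω N) :
    AEStronglyMeasurable (grad u) (volume.restrict Ω) := by
  refine (PiLp.continuous_toLp 2 _).comp_aestronglyMeasurable ?_
  refine (aemeasurable_pi_lambda _ fun p => ?_).aestronglyMeasurable
  exact ((EuclideanSpace.proj (𝕜 := ℝ) p.1).continuous.measurable.comp_aemeasurable
    (Lp.aestronglyMeasurable (weakD u p.2)).aemeasurable)

theorem aemeasurable_energy_density {L : Vec d → Vec N → Mat N d → EReal}
    (hL : IsCaratheodory Ω L) (u : W11 Ω N) :
    AEMeasurable (fun x => L x (fn u x) (grad u x)) (volume.restrict Ω) :=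
  aemeasurable_comp_of_continuous (f := fun x (p : Vec N × Mat N d) => L x p.1 p.2)
    hL.cont (fun p => hL.meas p.1 p.2)
    ((Lp.aestronglyMeasurable (fn u)).prodMk (aestronglyMeasurable_grad u))

theorem norm_weakD_le_norm_grad (u : W11 Ω N) (i : Fin d) (x : Vec d) :
    ‖weakD u i x‖ ≤ ‖grad u x‖ := by
  rw [EuclideanSpace.norm_eq, EuclideanSpace.norm_eq]
  refine Real.sqrt_le_sqrt ?_
  rw [Fintype.sum_prod_type]
  refine Finset.sum_le_sum fun j _ => ?_
  exact Finset.single_le_sum (f := fun k => ‖grad u x (j, k)‖ ^ 2) (fun _ _ => by positivity)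
    (Finset.mem_univ i)

end Energy

/-! ### Translation estimates and Poincaré's inequality for smooth functions -/

section Translation

variable {V F : Type*} [NormedAddCommGroup V] [NormedSpace ℝ V]
  [NormedAddCommGroup F] [NormedSpace ℝ F] [CompleteSpace F]

/-- Fundamental theorem of calculus along the segment from `x` to `x + h`. -/
theorem enorm_translate_sub_le {φ : V → F} (hφ : ContDiff ℝ 1 φ) (h x : V) :
    ‖φ (x + h) - φ x‖ₑ ≤ ∫⁻ t in Ioc (0 : ℝ) 1, ‖fderiv ℝ φ (x + t • h)‖ₑ * ‖h‖ₑ := by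
  have hd : ∀ t ∈ uIcc (0 : ℝ) 1,
      HasDerivAt (fun t : ℝ => φ (x + t • h)) (fderiv ℝ φ (x + t • h) h) t := by
    intro t _
    have h1 : HasDerivAt (fun t : ℝ => x + t • h) h t := by
      simpa using ((hasDerivAt_id t).smul_const h).const_add x
    exact ((hφ.differentiable (by simp)) _).hasFDerivAt.comp_hasDerivAt t h1
  have hc : Continuous fun t : ℝ => fderiv ℝ φ (x + t • h) h :=
    ((hφ.continuous_fderiv (by simp)).comp (by fun_prop)).clm_apply continuous_const
  have hftc := intervalIntegral.integral_eq_sub_of_hasDerivAt hd (hc.intervalIntegrable 0 1)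
  rw [one_smul, zero_smul, add_zero, intervalIntegral.integral_of_le zero_le_one] at hftc
  rw [← hftc]
  refine (enorm_integral_le_lintegral_enorm _).trans (lintegral_mono fun t => ?_)
  exact ContinuousLinearMap.le_opENorm _ _

variable [FiniteDimensional ℝ V] [MeasurableSpace V] [BorelSpace V]
  {μ : Measure V} [μ.IsAddHaarMeasure]

/-- Tonelli exchanges the integrals over `x` and over the segment; translation invariance then
removes the shift `t • h`. -/
theorem lintegral_enorm_translate_sub_le {φ : V → F} (hφ : ContDiff ℝ 1 φ) (h : V) :
    ∫⁻ x, ‖φ (x + h) - φ x‖ₑ ∂μ ≤ ‖h‖ₑ * ∫⁻ x, ‖fderiv ℝ φ x‖ₑ ∂μ := by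
  have hcf : Continuous (fderiv ℝ φ) := hφ.continuous_fderiv (by simp)
  calc ∫⁻ x, ‖φ (x + h) - φ x‖ₑ ∂μ
      ≤ ∫⁻ x, (∫⁻ t in Ioc (0 : ℝ) 1, ‖fderiv ℝ φ (x + t • h)‖ₑ * ‖h‖ₑ) ∂μ :=
        lintegral_mono fun x => enorm_translate_sub_le hφ h x
    _ = ∫⁻ t in Ioc (0 : ℝ) 1, (∫⁻ x, ‖fderiv ℝ φ (x + t • h)‖ₑ * ‖h‖ₑ ∂μ) := by
        refine lintegral_lintegral_swap (Continuous.measurable ?_).aemeasurable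
        have : Continuous fun p : V × ℝ => fderiv ℝ φ (p.1 + p.2 • h) :=
          hcf.comp (by fun_prop)
        exact ENNReal.continuous_mul_const enorm_ne_top |>.comp this.enorm
    _ = ∫⁻ _t in Ioc (0 : ℝ) 1, (‖h‖ₑ * ∫⁻ x, ‖fderiv ℝ φ x‖ₑ ∂μ) := by
        refine lintegral_congr fun t => ?_
        rw [lintegral_mul_const _ (by fun_prop), mul_comm,
          lintegral_add_right_eq_self (μ := μ) (fun x => ‖fderiv ℝ φ x‖ₑ) (t • h)]
    _ = ‖h‖ₑ * ∫⁻ x, ‖fderiv ℝ φ x‖ₑ ∂μ := by simp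

/-- The Poincaré inequality for functions supported in a bounded set. -/
theorem lintegral_enorm_le_mul_lintegral_fderiv [Nontrivial V] {φ : V → F}
    (hφ : ContDiff ℝ 1 φ) {R : ℝ} (hsupp : Function.support φ ⊆ Metric.ball 0 R) :
    ∫⁻ x, ‖φ x‖ₑ ∂μ ≤ ENNReal.ofReal (2 * R) * ∫⁻ x, ‖fderiv ℝ φ x‖ₑ ∂μ := by
  rcases le_or_gt R 0 with hR | hR
  · have : φ = 0 := by
      rw [Metric.ball_eq_empty.2 hR, subset_empty_iff, Function.support_eq_empty_iff] at hsupp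
      exact hsupp
    simp [this]
  -- Two points of the open ball of radius `R` differ by less than `2 * R`, so `φ` vanishes at `x +
  -- h` whenever it does not vanish at `x`.
  obtain ⟨h, hh⟩ := exists_norm_eq V (c := 2 * R) (by positivity)
  have hle : ∀ x, ‖φ x‖ₑ ≤ ‖φ (x + h) - φ x‖ₑ := by
    intro x
    by_cases hx : φ x = 0
    · simp [hx]
    have hxR := hsupp hx
    have : φ (x + h) = 0 := by
      by_contra hne
      have h2 := hsupp hne
      rw [mem_ball_zero_iff] at hxR h2
      have := norm_sub_le (x + h) x
      rw [add_sub_cancel_left, hh] at this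
      linarith
    simp [this]
  refine (lintegral_mono hle).trans ((lintegral_enorm_translate_sub_le hφ h).trans_eq ?_)
  rw [← ofReal_norm, hh]

end Translation

/-! ### Mollification and a quantitative Rellich theorem -/

section Mollify

variable {V F : Type*} [NormedAddCommGroup V] [InnerProductSpace ℝ V] [FiniteDimensional ℝ V]
  [MeasurableSpace V] [BorelSpace V] [NormedAddCommGroup F] [NormedSpace ℝ F]
  {μ : Measure V} [μ.IsAddHaarMeasure]

/-- The mollification of `φ` by the bump function `ρ`. -/
noncomputable def mollify (μ : Measure V) (ρ : ContDiffBump (0 : V)) (φ : V → F) (x : V) : F :=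
  ∫ z, ρ.normed μ z • φ (x + z) ∂μ

theorem mollify_eq (ρ : ContDiffBump (0 : V)) (φ : V → F) (x : V) :
    mollify μ ρ φ x = ∫ y, ρ.normed μ (y - x) • φ y ∂μ := by
  unfold mollify
  rw [← integral_add_right_eq_self (μ := μ) (fun y => ρ.normed μ (y - x) • φ y) x]
  simp [add_comm]

theorem integrable_normed_smul (ρ : ContDiffBump (0 : V)) {φ : V → F} (hφ : Integrable φ μ)
    (x : V) : Integrable (fun y => ρ.normed μ (y - x) • φ y) μ := by
  obtain ⟨C, hC⟩ := (ρ.hasCompactSupport_normed (μ := μ)).exists_bound_of_continuous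
    ρ.continuous_normed
  exact hφ.bdd_smul C (ρ.continuous_normed.comp (by fun_prop)).aestronglyMeasurable
    (Eventually.of_forall fun y => hC _)

/-- The kernel is bounded, and `C` depends on it alone; this uniformity in `φ` is the pointwise
boundedness required by Arzelà–Ascoli. -/
theorem exists_norm_mollify_le (ρ : ContDiffBump (0 : V)) :
    ∃ C : ℝ, ∀ φ : V → F, Integrable φ μ → ∀ x, ‖mollify μ ρ φ x‖ ≤ C * ∫ y, ‖φ y‖ ∂μ := by
  obtain ⟨C, hC⟩ := (ρ.hasCompactSupport_normed (μ := μ)).exists_bound_of_continuous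
    ρ.continuous_normed
  refine ⟨C, fun φ hφ x => ?_⟩
  rw [mollify_eq, ← integral_const_mul]
  refine norm_integral_le_of_norm_le (hφ.norm.const_mul C) (Eventually.of_forall fun y => ?_)
  rw [norm_smul]
  exact mul_le_mul_of_nonneg_right (hC _) (norm_nonneg _)

/-- Mollifications of an `L¹`-bounded family are equi-uniformly continuous. -/
theorem exists_norm_mollify_sub_le (ρ : ContDiffBump (0 : V)) {η : ℝ} (hη : 0 < η) :
    ∃ δ > 0, ∀ φ : V → F, Integrable φ μ → ∀ x x', dist x x' < δ →
      ‖mollify μ ρ φ x - mollify μ ρ φ x'‖ ≤ η * ∫ y, ‖φ y‖ ∂μ := by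
  have huc : UniformContinuous (ρ.normed μ) :=
    (ρ.hasCompactSupport_normed (μ := μ)).uniformContinuous_of_continuous ρ.continuous_normed
  obtain ⟨δ, hδ, h⟩ := Metric.uniformContinuous_iff.1 huc η hη
  refine ⟨δ, hδ, fun φ hφ x x' hx => ?_⟩
  rw [mollify_eq, mollify_eq,
    ← integral_sub (integrable_normed_smul ρ hφ x) (integrable_normed_smul ρ hφ x'),
    ← integral_const_mul]
  refine norm_integral_le_of_norm_le (hφ.norm.const_mul η) (Eventually.of_forall fun y => ?_)
  rw [← sub_smul, norm_smul]
  refine mul_le_mul_of_nonneg_right ?_ (norm_nonneg _)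
  have hd : dist (y - x) (y - x') < δ := by rwa [dist_sub_left]
  simpa [dist_eq_norm] using (h hd).le

theorem continuous_mollify (ρ : ContDiffBump (0 : V)) {φ : V → F} (hφ : Integrable φ μ) :
    Continuous (mollify μ ρ φ) := by
  refine Metric.continuous_iff.2 fun x ε hε => ?_
  have hB : 0 ≤ ∫ y, ‖φ y‖ ∂μ := integral_nonneg fun _ => norm_nonneg _
  obtain ⟨δ, hδ, h⟩ := exists_norm_mollify_sub_le (F := F) (μ := μ) ρ
    (η := ε / (∫ y, ‖φ y‖ ∂μ + 1)) (by positivity)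
  refine ⟨δ, hδ, fun y hy => ?_⟩
  rw [dist_eq_norm]
  refine (h φ hφ y x hy).trans_lt ?_
  rw [div_mul_eq_mul_div, div_lt_iff₀ (by positivity)]
  nlinarith

/-- The mollification is an average of translates by vectors shorter than `ρ.rOut`, each of which
obeys the translation estimate. -/
theorem lintegral_enorm_mollify_sub_le [CompleteSpace F] (ρ : ContDiffBump (0 : V)) {φ : V → F}
    (hφ : ContDiff ℝ 1 φ) :
    ∫⁻ x, ‖mollify μ ρ φ x - φ x‖ₑ ∂μ
      ≤ ENNReal.ofReal ρ.rOut * ∫⁻ x, ‖fderiv ℝ φ x‖ₑ ∂μ := by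
  have hcont := hφ.continuous
  have hρ := ρ.continuous_normed (μ := μ)
  set G := ∫⁻ x, ‖fderiv ℝ φ x‖ₑ ∂μ
  have hpt : ∀ x, ‖mollify μ ρ φ x - φ x‖ₑ
      ≤ ∫⁻ z, ‖ρ.normed μ z‖ₑ * ‖φ (x + z) - φ x‖ₑ ∂μ := by
    intro x
    have h1 : Integrable (fun z => ρ.normed μ z • φ (x + z)) μ :=
      Continuous.integrable_of_hasCompactSupport (hρ.smul (by fun_prop))
        ρ.hasCompactSupport_normed.smul_right
    have h2 : Integrable (fun z => ρ.normed μ z • φ x) μ := ρ.integrable_normed.smul_const _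
    have : mollify μ ρ φ x - φ x = ∫ z, ρ.normed μ z • (φ (x + z) - φ x) ∂μ := by
      simp only [smul_sub]
      rw [integral_sub h1 h2, integral_smul_const, ρ.integral_normed, one_smul]
      rfl
    rw [this]
    refine (enorm_integral_le_lintegral_enorm _).trans_eq ?_
    simp only [enorm_smul]
  calc ∫⁻ x, ‖mollify μ ρ φ x - φ x‖ₑ ∂μ
      ≤ ∫⁻ x, (∫⁻ z, ‖ρ.normed μ z‖ₑ * ‖φ (x + z) - φ x‖ₑ ∂μ) ∂μ := lintegral_mono hpt
    _ = ∫⁻ z, (∫⁻ x, ‖ρ.normed μ z‖ₑ * ‖φ (x + z) - φ x‖ₑ ∂μ) ∂μ := by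
        refine lintegral_lintegral_swap (Measurable.aemeasurable ?_)
        have h1 : Measurable fun p : V × V => ‖ρ.normed μ p.2‖ₑ :=
          (hρ.comp continuous_snd).enorm.measurable
        have h2 : Measurable fun p : V × V => ‖φ (p.1 + p.2) - φ p.1‖ₑ :=
          ((hcont.comp (continuous_fst.add continuous_snd)).sub
            (hcont.comp continuous_fst)).enorm.measurable
        exact h1.mul h2
    _ ≤ ∫⁻ z, ‖ρ.normed μ z‖ₑ * (ENNReal.ofReal ρ.rOut * G) ∂μ := by
        refine lintegral_mono fun z => ?_
        have hm : Measurable fun x => ‖φ (x + z) - φ x‖ₑ :=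
          ((hcont.comp (continuous_id.add continuous_const)).sub hcont).enorm.measurable
        rw [lintegral_const_mul _ hm]
        by_cases hz : ρ.normed μ z = 0
        · simp [hz]
        refine mul_le_mul_right ((lintegral_enorm_translate_sub_le hφ z).trans ?_) _
        refine mul_le_mul_left ?_ _
        have : z ∈ Metric.ball 0 ρ.rOut := by
          rw [← ρ.support_normed_eq (μ := μ)]; exact hz
        rw [← ofReal_norm]
        exact ENNReal.ofReal_le_ofReal (mem_ball_zero_iff.1 this).le
    _ = ENNReal.ofReal ρ.rOut * G := by
        rw [lintegral_mul_const _ hρ.enorm.measurable]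
        have : ∫⁻ z, ‖ρ.normed μ z‖ₑ ∂μ = 1 := by
          rw [← ofReal_integral_norm_eq_lintegral_enorm ρ.integrable_normed]
          simp only [Real.norm_of_nonneg (ρ.nonneg_normed _), ρ.integral_normed, ENNReal.ofReal_one]
        rw [this, one_mul]

/-- A quantitative form of Rellich's theorem: smooth functions that are bounded in `W^{1,1}` can be
approximated in `L¹` of a bounded set by finitely many of them. -/
theorem exists_finite_net_of_lintegral_fderiv_le [FiniteDimensional ℝ F] {ι : Type*}
    {φ : ι → V → F} (hφ : ∀ n, ContDiff ℝ 1 (φ n)) (hi : ∀ n, Integrable (φ n) μ)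
    {B G : ℝ} (hB : ∀ n, ∫ x, ‖φ n x‖ ∂μ ≤ B)
    (hG : ∀ n, ∫⁻ x, ‖fderiv ℝ (φ n) x‖ₑ ∂μ ≤ ENNReal.ofReal G)
    {S : Set V} (hS : Bornology.IsBounded S) {ε : ℝ} (hε : 0 < ε) :
    ∃ t : Set ι, t.Finite ∧ ∀ n, ∃ m ∈ t,
      ∫⁻ x in S, ‖φ n x - φ m x‖ₑ ∂μ ≤ ENNReal.ofReal ε := by
  have : CompleteSpace F := FiniteDimensional.complete ℝ F
  have : ProperSpace F := FiniteDimensional.proper ℝ F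
  have : ProperSpace V := FiniteDimensional.proper ℝ V
  obtain ⟨R, hR⟩ := hS.subset_closedBall 0
  have hG' : ∀ n, ∫⁻ x, ‖fderiv ℝ (φ n) x‖ₑ ∂μ ≤ ENNReal.ofReal |G| := fun n =>
    (hG n).trans (ENNReal.ofReal_le_ofReal (le_abs_self G))
  -- With this radius each mollification error is at most `ε / 4` in `L¹`, uniformly in the index.
  -- At fixed radius the mollified family is precompact in the uniform norm on a closed ball
  -- containing `S`.
  set r : ℝ := ε / (4 * (|G| + 1)) with hr
  have hrpos : 0 < r := by positivity
  let ρ : ContDiffBump (0 : V) := ⟨r / 2, r, by positivity, by linarith⟩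
  have hρr : ρ.rOut = r := rfl
  let X := Metric.closedBall (0 : V) R
  have : CompactSpace X := isCompact_iff_compactSpace.1 (isCompact_closedBall _ _)
  let Φ : ι → BoundedContinuousFunction X F := fun n =>
    BoundedContinuousFunction.mkOfCompact
      ⟨fun x => mollify μ ρ (φ n) x, (continuous_mollify ρ (hi n)).comp continuous_subtype_val⟩
  have hΦ : ∀ n (x : X), Φ n x = mollify μ ρ (φ n) x := fun _ _ => rfl
  obtain ⟨C, hC⟩ := exists_norm_mollify_le (F := F) (μ := μ) ρ
  have hcomp : IsCompact (closure (range Φ)) := by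
    refine BoundedContinuousFunction.arzela_ascoli (Metric.closedBall 0 (|C| * |B|))
      (isCompact_closedBall _ _) _ ?_ ?_
    · rintro _ x ⟨n, rfl⟩
      rw [mem_closedBall_zero_iff, hΦ]
      refine (hC _ (hi n) x).trans ?_
      refine mul_le_mul (le_abs_self C) ((hB n).trans (le_abs_self B))
        (integral_nonneg fun _ => norm_nonneg _) (abs_nonneg _)
    · refine UniformEquicontinuous.equicontinuous (Metric.uniformEquicontinuous_iff.2 ?_)
      intro η hη
      obtain ⟨δ, hδ, h⟩ := exists_norm_mollify_sub_le (F := F) (μ := μ) ρ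
        (η := η / (|B| + 1)) (by positivity)
      refine ⟨δ, hδ, ?_⟩
      rintro x y hxy ⟨_, n, rfl⟩
      simp only [hΦ]
      rw [dist_eq_norm]
      refine (h _ (hi n) _ _ hxy).trans_lt ?_
      rw [div_mul_eq_mul_div, div_lt_iff₀ (by positivity)]
      have := (hB n).trans (le_abs_self B)
      nlinarith
  have hvol : μ X ≠ ⊤ := (isCompact_closedBall (0 : V) R).measure_lt_top.ne
  -- Uniform distance `η` costs at most `ε / 2` in `L¹` of the ball; two mollification errors use up
  -- the rest.
  set η : ℝ := ε / (2 * ((μ X).toReal + 1)) with hηdef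
  have hη : 0 < η := by positivity
  -- The primed form puts the centres of the net in the range of `Φ`, so that they come from
  -- indices.
  obtain ⟨T, hTsub, hTfin, hT⟩ := (EMetric.totallyBounded_iff'.1
    (hcomp.totallyBounded.subset subset_closure)) (ENNReal.ofReal η) (by simpa using hη)
  rcases isEmpty_or_nonempty ι with _ | _
  · exact ⟨∅, finite_empty, isEmptyElim⟩
  choose! idx hidx using fun f (hf : f ∈ T) => hTsub hf
  refine ⟨idx '' T, hTfin.image _, fun n => ?_⟩
  have hn := hT (mem_range_self n)
  simp only [mem_iUnion] at hn
  obtain ⟨f, hfT, hf⟩ := hn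
  refine ⟨idx f, mem_image_of_mem _ hfT, ?_⟩
  set m := idx f
  have hmf : Φ m = f := hidx f hfT
  rw [← hmf] at hf
  have hmid : ∀ x ∈ S, ‖mollify μ ρ (φ n) x - mollify μ ρ (φ m) x‖ₑ ≤ ENNReal.ofReal η := by
    intro x hx
    rw [← hΦ n ⟨x, hR hx⟩, ← hΦ m ⟨x, hR hx⟩, ← edist_eq_enorm_sub]
    rw [Metric.mem_eball, edist_dist] at hf
    rw [edist_dist]
    refine (ENNReal.ofReal_le_ofReal ?_).trans hf.le
    exact BoundedContinuousFunction.dist_coe_le_dist _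
  have hmol : ∀ k, ∫⁻ x in S, ‖mollify μ ρ (φ k) x - φ k x‖ₑ ∂μ ≤ ENNReal.ofReal (ε / 4) := by
    intro k
    refine (setLIntegral_le_lintegral _ _).trans ?_
    refine (lintegral_enorm_mollify_sub_le ρ (hφ k)).trans ?_
    refine (mul_le_mul_right (hG' k) _).trans ?_
    rw [hρr, ← ENNReal.ofReal_mul hrpos.le]
    refine ENNReal.ofReal_le_ofReal ?_
    rw [hr, div_mul_eq_mul_div, div_le_iff₀ (by positivity)]
    nlinarith [abs_nonneg G]
  have hmeas : ∀ k, Measurable fun x => ‖mollify μ ρ (φ k) x - φ k x‖ₑ := fun k =>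
    ((continuous_mollify ρ (hi k)).sub (hφ k).continuous).enorm.measurable
  calc ∫⁻ x in S, ‖φ n x - φ m x‖ₑ ∂μ
      ≤ ∫⁻ x in S, (‖mollify μ ρ (φ n) x - φ n x‖ₑ + ‖mollify μ ρ (φ m) x - φ m x‖ₑ
          + ‖mollify μ ρ (φ n) x - mollify μ ρ (φ m) x‖ₑ) ∂μ := by
        refine lintegral_mono fun x => ?_
        have : φ n x - φ m x = -(mollify μ ρ (φ n) x - φ n x) + (mollify μ ρ (φ m) x - φ m x)
          + (mollify μ ρ (φ n) x - mollify μ ρ (φ m) x) := by abel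
        rw [this]
        refine (enorm_add_le _ _).trans (add_le_add_left ((enorm_add_le _ _).trans ?_) _)
        rw [enorm_neg]
    _ = ∫⁻ x in S, ‖mollify μ ρ (φ n) x - φ n x‖ₑ ∂μ
          + ∫⁻ x in S, ‖mollify μ ρ (φ m) x - φ m x‖ₑ ∂μ
          + ∫⁻ x in S, ‖mollify μ ρ (φ n) x - mollify μ ρ (φ m) x‖ₑ ∂μ := by
        have h2 : Measurable fun x => ‖mollify μ ρ (φ n) x - φ n x‖ₑ
            + ‖mollify μ ρ (φ m) x - φ m x‖ₑ := (hmeas n).add (hmeas m)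
        rw [lintegral_add_left h2, lintegral_add_left (hmeas n)]
    _ ≤ ENNReal.ofReal (ε / 4) + ENNReal.ofReal (ε / 4) + ENNReal.ofReal (ε / 2) := by
        refine add_le_add (add_le_add (hmol n) (hmol m)) ?_
        refine (setLIntegral_mono measurable_const hmid).trans ?_
        rw [setLIntegral_const]
        refine (mul_le_mul_right (measure_mono hR) _).trans ?_
        rw [← ENNReal.ofReal_toReal hvol, ← ENNReal.ofReal_mul hη.le]
        refine ENNReal.ofReal_le_ofReal ?_
        rw [hηdef, div_mul_eq_mul_div, div_le_iff₀ (by positivity)]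
        have : 0 ≤ (μ X).toReal := ENNReal.toReal_nonneg
        nlinarith
    _ = ENNReal.ofReal ε := by
        rw [← ENNReal.ofReal_add (by positivity) (by positivity),
          ← ENNReal.ofReal_add (by positivity) (by positivity)]
        congr 1; ring

end Mollify

/-! ### Almost everywhere convergence from Cauchyness in measure -/

section AeSubsequence

/-- A sequence that is Cauchy in measure has an almost everywhere convergent subsequence. -/
theorem exists_subseq_ae_tendsto {X E : Type*} [MeasurableSpace X] {μ : Measure X}
    [NormedAddCommGroup E] [CompleteSpace E] {g : ℕ → X → E}
    (hg : ∀ n, AEStronglyMeasurable (g n) μ)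
    (hcau : ∀ ε : ℝ, 0 < ε → ∃ n₀, ∀ n ≥ n₀, ∀ m ≥ n,
      ∫⁻ x, min 1 (edist (g n x) (g m x)) ∂μ ≤ ENNReal.ofReal ε) :
    ∃ ψ : ℕ → ℕ, StrictMono ψ ∧ ∃ f : X → E,
      ∀ᵐ x ∂μ, Tendsto (fun k => g (ψ k) x) atTop (𝓝 (f x)) := by
  obtain ⟨ψ, hψ, hψc⟩ := extraction_forall_of_eventually'
    (P := fun k n => ∀ m ≥ n, ∫⁻ x, min 1 (edist (g n x) (g m x)) ∂μ
      ≤ ENNReal.ofReal ((1 / 2 : ℝ) ^ k))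
    (fun k => hcau ((1 / 2 : ℝ) ^ k) (by positivity))
  set b : ℕ → X → ℝ≥0∞ := fun k x => min 1 (edist (g (ψ k) x) (g (ψ (k + 1)) x))
  have hbm : ∀ k, AEMeasurable (b k) μ := fun k =>
    aemeasurable_const.min ((hg _).edist (hg _))
  have hsum : ∫⁻ x, ∑' k, b k x ∂μ ≠ ⊤ := by
    rw [lintegral_tsum hbm]
    refine ne_top_of_le_ne_top (b := ∑' k : ℕ, ENNReal.ofReal ((1 / 2 : ℝ) ^ k)) ?_
      (ENNReal.tsum_le_tsum fun k => hψc k _ (hψ (Nat.lt_succ_self k)).le)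
    rw [← ENNReal.ofReal_tsum_of_nonneg (fun _ => by positivity) summable_geometric_two]
    exact ENNReal.ofReal_ne_top
  have hae : ∀ᵐ x ∂μ, ∃ y, Tendsto (fun k => g (ψ k) x) atTop (𝓝 y) := by
    filter_upwards [ae_lt_top' (AEMeasurable.tsum hbm) hsum] with x hx
    -- The terms of a convergent series are eventually below 1, where the truncation is inactive;
    -- from there on the increments themselves are summable.
    have hto := ENNReal.tendsto_atTop_zero_of_tsum_ne_top hx.ne
    obtain ⟨K, hK⟩ := eventually_atTop.1 (hto.eventually_lt_const one_pos)
    have heq : ∀ k, edist (g (ψ (k + K)) x) (g (ψ (k + 1 + K)) x) = b (k + K) x := by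
      intro k
      have h1 : b (k + K) x < 1 := hK _ (Nat.le_add_left _ _)
      have h2 : min 1 (edist (g (ψ (k + K)) x) (g (ψ (k + K + 1)) x)) < 1 := h1
      change _ = min 1 (edist (g (ψ (k + K)) x) (g (ψ (k + K + 1)) x))
      rw [min_eq_right (le_of_lt (by simpa using h2)), Nat.add_right_comm]
    have hc : CauchySeq fun k => g (ψ (k + K)) x := by
      refine cauchySeq_of_edist_le_of_tsum_ne_top (fun k => b (k + K) x)
        (fun k => (heq k).le) (ne_top_of_le_ne_top hx.ne ?_)
      exact ENNReal.tsum_comp_le_tsum_of_injective (add_left_injective K) _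
    obtain ⟨y, hy⟩ := cauchySeq_tendsto_of_complete hc
    exact ⟨y, (tendsto_add_atTop_iff_nat (f := fun k => g (ψ k) x) K).1 hy⟩
  classical
  refine ⟨ψ, hψ, fun x => if h : ∃ y, Tendsto (fun k => g (ψ k) x) atTop (𝓝 y) then h.choose
    else 0, ?_⟩
  filter_upwards [hae] with x hx
  rw [dif_pos hx]
  exact hx.choose_spec

end AeSubsequence

/-! ### Komlós-type selection by minimizing a strictly convex functional -/

section StrictlyConvexMinimization

variable {E : Type*} [NormedAddCommGroup E]

/-- The strictly convex function `√(1 + ‖y‖²)`. -/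
noncomputable def areaFn (y : E) : ℝ := √(1 + ‖y‖ ^ 2)

theorem one_le_areaFn (y : E) : 1 ≤ areaFn y :=
  Real.one_le_sqrt.2 (by nlinarith [sq_nonneg ‖y‖])

theorem areaFn_sq (y : E) : areaFn y ^ 2 = 1 + ‖y‖ ^ 2 := Real.sq_sqrt (by positivity)

theorem areaFn_le (y : E) : areaFn y ≤ 1 + ‖y‖ :=
  Real.sqrt_le_iff.2 ⟨by positivity, by nlinarith [norm_nonneg y]⟩

theorem continuous_areaFn : Continuous (areaFn : E → ℝ) := by
  unfold areaFn; fun_prop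

variable {X : Type*} [MeasurableSpace X] {μ : Measure X} [IsFiniteMeasure μ]

theorem integrable_areaFn {f : X → E} (hf : Integrable f μ) :
    Integrable (fun x => areaFn (f x)) μ := by
  refine ((integrable_const (1 : ℝ)).add hf.norm).mono'
    (continuous_areaFn.comp_aestronglyMeasurable hf.1) (Eventually.of_forall fun x => ?_)
  rw [Real.norm_of_nonneg (by linarith [one_le_areaFn (f x)])]
  exact areaFn_le _

variable [InnerProductSpace ℝ E]

/-- The convexity deficit of `areaFn` controls the distance of the two points. -/
theorem norm_sub_sq_le_areaFn (p q : E) :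
    0 ≤ areaFn p + areaFn q - 2 * areaFn ((1 / 2 : ℝ) • p + (1 / 2 : ℝ) • q) ∧
    ‖p - q‖ ^ 2 ≤ (areaFn p + areaFn q) ^ 3 / 2 *
      (areaFn p + areaFn q - 2 * areaFn ((1 / 2 : ℝ) • p + (1 / 2 : ℝ) • q)) := by
  set P := areaFn p
  set Q := areaFn q
  set R := 2 * areaFn ((1 / 2 : ℝ) • p + (1 / 2 : ℝ) • q) with hR
  have hP : 1 ≤ P := one_le_areaFn p
  have hQ : 1 ≤ Q := one_le_areaFn q
  have hR1 : 2 ≤ R := by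
    have := one_le_areaFn ((1 / 2 : ℝ) • p + (1 / 2 : ℝ) • q)
    linarith
  have hP2 : P ^ 2 = 1 + ‖p‖ ^ 2 := areaFn_sq p
  have hQ2 : Q ^ 2 = 1 + ‖q‖ ^ 2 := areaFn_sq q
  have hR2 : R ^ 2 = 4 + ‖p‖ ^ 2 + 2 * inner ℝ p q + ‖q‖ ^ 2 := by
    rw [hR, mul_pow, areaFn_sq, ← smul_add, norm_smul, mul_pow, norm_add_sq_real]
    norm_num
    ring
  set s : ℝ := inner ℝ p q
  have hsub : ‖p - q‖ ^ 2 = ‖p‖ ^ 2 - 2 * s + ‖q‖ ^ 2 := norm_sub_sq_real p q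
  have hcs : |s| ≤ ‖p‖ * ‖q‖ := abs_real_inner_le_norm p q
  have hs2 : s ^ 2 ≤ ‖p‖ ^ 2 * ‖q‖ ^ 2 := by
    rw [← mul_pow, ← sq_abs s]
    exact pow_le_pow_left₀ (abs_nonneg _) hcs 2
  -- The right-hand side equals `‖p - q‖²` plus the Cauchy–Schwarz defect `‖p‖²‖q‖² - s²`.
  have hprod : ‖p - q‖ ^ 2 ≤ (P * Q) ^ 2 - (1 + s) ^ 2 := by
    rw [mul_pow, hP2, hQ2, hsub]; nlinarith
  have h0 : 0 ≤ ‖p - q‖ ^ 2 := by positivity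
  have hPQ : 1 ≤ P * Q := one_le_mul_of_one_le_of_one_le hP hQ
  have hle : 1 + s ≤ P * Q := (le_abs_self _).trans
    (abs_le_of_sq_le_sq (by linarith) (by linarith))
  have hdiff : (P + Q) ^ 2 - R ^ 2 = 2 * (P * Q - (1 + s)) := by
    rw [hR2, add_sq, hP2, hQ2]; ring
  have hD : 0 ≤ P + Q - R := by
    have : R ≤ P + Q := by
      refine (sq_le_sq₀ (by linarith) (by linarith)).1 ?_
      linarith
    linarith
  refine ⟨hD, ?_⟩
  have h1 : ‖p - q‖ ^ 2 ≤ (P * Q - (1 + s)) * (2 * (P * Q)) := by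
    have : (P * Q) ^ 2 - (1 + s) ^ 2 = (P * Q - (1 + s)) * (P * Q + (1 + s)) := by ring
    rw [this] at hprod
    refine hprod.trans (mul_le_mul_of_nonneg_left (by linarith) (by linarith))
  have h2 : P * Q - (1 + s) ≤ (P + Q) * (P + Q - R) := by
    have : (P + Q) ^ 2 - R ^ 2 = (P + Q - R) * (P + Q + R) := by ring
    have h3 : (P + Q - R) * (P + Q + R) ≤ (P + Q - R) * (2 * (P + Q)) :=
      mul_le_mul_of_nonneg_left (by linarith) hD
    linarith
  have h3 : 2 * (P * Q) ≤ (P + Q) ^ 2 / 2 := by nlinarith [sq_nonneg (P - Q)]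
  calc ‖p - q‖ ^ 2 ≤ (P * Q - (1 + s)) * (2 * (P * Q)) := h1
    _ ≤ ((P + Q) * (P + Q - R)) * ((P + Q) ^ 2 / 2) :=
        mul_le_mul h2 h3 (by positivity) (mul_nonneg (by linarith) hD)
    _ = _ := by ring

/-- Makes the previous estimate linear in quantities whose integrals are controlled. Where `areaFn p
+ areaFn q` is at least `1 / η`, the first term alone exceeds 1; elsewhere the cubic factor is
bounded and Young's inequality removes the square. -/
theorem min_one_norm_sub_le (p q : E) {η : ℝ} (hη : 0 < η) :
    min 1 ‖p - q‖ ≤ η * (areaFn p + areaFn q) +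
      (areaFn p + areaFn q - 2 * areaFn ((1 / 2 : ℝ) • p + (1 / 2 : ℝ) • q)) / (8 * η ^ 4) := by
  obtain ⟨hD, h⟩ := norm_sub_sq_le_areaFn p q
  set D := areaFn p + areaFn q - 2 * areaFn ((1 / 2 : ℝ) • p + (1 / 2 : ℝ) • q)
  set s := areaFn p + areaFn q
  have hs : 2 ≤ s := by linarith [one_le_areaFn p, one_le_areaFn q]
  have hD' : 0 ≤ D / (8 * η ^ 4) := by positivity
  rcases le_or_gt 1 (η * s) with h1 | h1
  · exact (min_le_left _ _).trans (by linarith)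
  · refine (min_le_right _ _).trans ?_
    set z := ‖p - q‖
    have hs3 : (η * s) ^ 3 ≤ 1 := pow_le_one₀ (by positivity) h1.le
    have hz : η ^ 3 * z ^ 2 ≤ D / 2 := by
      have : η ^ 3 * z ^ 2 ≤ η ^ 3 * (s ^ 3 / 2 * D) := by gcongr
      have h2 : η ^ 3 * (s ^ 3 / 2 * D) = (η * s) ^ 3 * (D / 2) := by ring
      nlinarith
    have hz2 : z ≤ η + z ^ 2 / (4 * η) := by
      have : η + z ^ 2 / (4 * η) - z = (z - 2 * η) ^ 2 / (4 * η) := by field_simp; ring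
      have : 0 ≤ (z - 2 * η) ^ 2 / (4 * η) := by positivity
      linarith
    have hz3 : z ^ 2 / (4 * η) ≤ D / (8 * η ^ 4) := by
      rw [div_le_div_iff₀ (by positivity) (by positivity)]
      have : z ^ 2 * (8 * η ^ 4) = (η ^ 3 * z ^ 2) * (8 * η) := by ring
      rw [this]
      nlinarith
    nlinarith

/-- A Komlós-type theorem: a decreasing sequence of nonempty convex sets of functions, bounded in
`L¹`, admits a selection that converges almost everywhere. -/
theorem exists_ae_tendsto_of_antitone_convex [CompleteSpace E] {P : Type*} [AddCommGroup P]
    [Module ℝ P] (T : P → X → E) (hT : ∀ p, Integrable (T p) μ)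
    (hmid : ∀ p q, T ((1 / 2 : ℝ) • p + (1 / 2 : ℝ) • q)
      =ᵐ[μ] fun x => (1 / 2 : ℝ) • T p x + (1 / 2 : ℝ) • T q x)
    {C : ℕ → Set P} (hanti : Antitone C) (hconv : ∀ n, Convex ℝ (C n))
    (hne : ∀ n, (C n).Nonempty) {M : ℝ} (hM : ∀ p ∈ C 0, ∫ x, ‖T p x‖ ∂μ ≤ M) :
    ∃ p : ℕ → P, (∀ n, p n ∈ C n) ∧ ∃ f : X → E,
      ∀ᵐ x ∂μ, Tendsto (fun n => T (p n) x) atTop (𝓝 (f x)) := by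
  set Φ : P → ℝ := fun p => ∫ x, areaFn (T p x) ∂μ with hΦ
  have hi : ∀ p, Integrable (fun x => areaFn (T p x)) μ := fun p => integrable_areaFn (hT p)
  have hΦ0 : ∀ p, 0 ≤ Φ p := fun p =>
    integral_nonneg fun x => zero_le_one.trans (one_le_areaFn _)
  set K : ℝ := μ.real univ + M
  have hΦK : ∀ n, ∀ p ∈ C n, Φ p ≤ K := by
    intro n p hp
    have h1 : Φ p ≤ ∫ x, (1 + ‖T p x‖) ∂μ :=
      integral_mono (hi p) ((integrable_const _).add (hT p).norm) fun x => areaFn_le _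
    rw [integral_add (integrable_const _) (hT p).norm] at h1
    have h2 := hM p (hanti (Nat.zero_le n) hp)
    simp only [integral_const, smul_eq_mul, mul_one] at h1
    linarith
  set s : ℕ → ℝ := fun n => sInf (Φ '' C n) with hs
  have hbdd : ∀ n, BddBelow (Φ '' C n) := fun n =>
    ⟨0, by rintro _ ⟨p, _, rfl⟩; exact hΦ0 p⟩
  have hsle : ∀ n, ∀ p ∈ C n, s n ≤ Φ p := fun n p hp => csInf_le (hbdd n) (mem_image_of_mem _ hp)
  have hsmono : Monotone s := fun n m hnm =>
    csInf_le_csInf (hbdd n) ((hne m).image _) (image_mono (hanti hnm))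
  have hsK : BddAbove (range s) := by
    refine ⟨K, ?_⟩
    rintro _ ⟨n, rfl⟩
    obtain ⟨p, hp⟩ := hne n
    exact (hsle n p hp).trans (hΦK n p hp)
  have hsel : ∀ n, ∃ p ∈ C n, Φ p < s n + 1 / ((n : ℝ) + 1) := by
    intro n
    obtain ⟨_, ⟨p, hp, rfl⟩, hlt⟩ := exists_lt_of_csInf_lt ((hne n).image Φ)
      (show sInf (Φ '' C n) < s n + 1 / ((n : ℝ) + 1) from
        lt_add_of_pos_right _ (by positivity))
    exact ⟨p, hp, hlt⟩
  choose p hpC hpΦ using hsel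
  set S : ℝ := ⨆ n, s n
  have hsS : ∀ n, s n ≤ S := fun n => le_ciSup hsK n
  -- Bound for `Φ (p n) + Φ (p m) - 2 * s n` with `m ≥ n`: the values are at most `s n + 1 / (n +
  -- 1)` and `S + 1 / (n + 1)`.
  set e : ℕ → ℝ := fun n => (S - s n) + 2 * (1 / ((n : ℝ) + 1)) with he
  have hlim : Tendsto e atTop (𝓝 0) := by
    have h1 : Tendsto s atTop (𝓝 S) := tendsto_atTop_ciSup hsmono hsK
    have h2 := (h1.const_sub S).add (tendsto_one_div_add_atTop_nhds_zero_nat.const_mul (2 : ℝ))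
    simpa [he] using h2
  have hiS : ∀ n m, Integrable (fun x => areaFn (T (p n) x) + areaFn (T (p m) x)) μ :=
    fun n m => (hi _).add (hi _)
  have hi2 : ∀ n m, Integrable (fun x =>
      areaFn ((1 / 2 : ℝ) • T (p n) x + (1 / 2 : ℝ) • T (p m) x)) μ :=
    fun n m => integrable_areaFn (((hT _).smul _).add ((hT _).smul _))
  have hiD : ∀ n m, Integrable (fun x => areaFn (T (p n) x) + areaFn (T (p m) x)
      - 2 * areaFn ((1 / 2 : ℝ) • T (p n) x + (1 / 2 : ℝ) • T (p m) x)) μ :=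
    fun n m => (hiS n m).sub ((hi2 n m).const_mul 2)
  have hdef : ∀ n, ∀ m ≥ n, ∫ x, (areaFn (T (p n) x) + areaFn (T (p m) x)
      - 2 * areaFn ((1 / 2 : ℝ) • T (p n) x + (1 / 2 : ℝ) • T (p m) x)) ∂μ ≤ e n := by
    intro n m hnm
    -- The midpoint competes in `C n`, so its value is at least `s n`; hence the integrated
    -- convexity deficit is at most `e n`.
    have hmem : (1 / 2 : ℝ) • p n + (1 / 2 : ℝ) • p m ∈ C n :=
      hconv n (hpC n) (hanti hnm (hpC m)) (by norm_num) (by norm_num) (by norm_num)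
    have h1 := hsle n _ hmem
    have h2 : Φ ((1 / 2 : ℝ) • p n + (1 / 2 : ℝ) • p m)
        = ∫ x, areaFn ((1 / 2 : ℝ) • T (p n) x + (1 / 2 : ℝ) • T (p m) x) ∂μ := by
      refine integral_congr_ae ?_
      filter_upwards [hmid (p n) (p m)] with x hx
      rw [hx]
    rw [integral_sub (hiS n m) ((hi2 n m).const_mul 2), integral_add (hi _) (hi _),
      integral_const_mul, ← h2]
    have h3 : 1 / ((m : ℝ) + 1) ≤ 1 / ((n : ℝ) + 1) :=
      one_div_le_one_div_of_le (by positivity) (by exact_mod_cast Nat.succ_le_succ hnm)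
    have h4 := hpΦ n
    have h5 := hpΦ m
    have h6 := hsS m
    simp only [hΦ] at h4 h5 h1
    simp only [he]
    linarith
  have hK : 0 ≤ K := (hΦ0 _).trans (hΦK 0 _ (hpC 0))
  obtain ⟨ψ, hψ, f, hf⟩ := exists_subseq_ae_tendsto (μ := μ) (g := fun n => T (p n))
    (fun n => (hT _).1) (by
      intro ε hε
      -- First `η` makes the mass term at most `ε / 2`; then `n₀` makes the deficit small compared
      -- with the fixed number `8 * η ^ 4`.
      set η : ℝ := ε / (4 * (K + 1)) with hη
      have hηpos : 0 < η := by positivity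
      have hηK : η * (2 * K) ≤ ε / 2 := by
        rw [hη, div_mul_eq_mul_div, div_le_iff₀ (by positivity)]; nlinarith
      obtain ⟨n₀, hn₀⟩ := eventually_atTop.1
        (hlim.eventually_lt_const (show 0 < ε / 2 * (8 * η ^ 4) by positivity))
      refine ⟨n₀, fun n hn m hm => ?_⟩
      have hpt : ∀ x, min 1 (edist (T (p n) x) (T (p m) x)) ≤ ENNReal.ofReal
          (η * (areaFn (T (p n) x) + areaFn (T (p m) x)) +
            (areaFn (T (p n) x) + areaFn (T (p m) x)
              - 2 * areaFn ((1 / 2 : ℝ) • T (p n) x + (1 / 2 : ℝ) • T (p m) x)) / (8 * η ^ 4)) := by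
        intro x
        rw [edist_dist, dist_eq_norm, ← ENNReal.ofReal_one, ← ENNReal.ofReal_min]
        exact ENNReal.ofReal_le_ofReal (min_one_norm_sub_le _ _ hηpos)
      have hiB : Integrable (fun x => η * (areaFn (T (p n) x) + areaFn (T (p m) x)) +
          (areaFn (T (p n) x) + areaFn (T (p m) x)
            - 2 * areaFn ((1 / 2 : ℝ) • T (p n) x + (1 / 2 : ℝ) • T (p m) x)) / (8 * η ^ 4)) μ :=
        ((hiS n m).const_mul η).add ((hiD n m).div_const _)
      refine (lintegral_mono hpt).trans ?_
      rw [← ofReal_integral_eq_lintegral_ofReal hiB (Eventually.of_forall fun x => by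
        have h1 := min_one_norm_sub_le (T (p n) x) (T (p m) x) hηpos
        exact (le_min zero_le_one (norm_nonneg _)).trans h1)]
      refine ENNReal.ofReal_le_ofReal ?_
      rw [integral_add ((hiS n m).const_mul η) ((hiD n m).div_const _), integral_const_mul, integral_div]
      have h1 : ∫ x, (areaFn (T (p n) x) + areaFn (T (p m) x)) ∂μ ≤ 2 * K := by
        rw [integral_add (hi _) (hi _)]
        have := hΦK n _ (hpC n)
        have := hΦK m _ (hpC m)
        simp only [hΦ] at *
        linarith
      have h2 := (hdef n m hm).trans (hn₀ n hn).le
      rw [← div_le_iff₀ (by positivity)] at h2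
      have h3 := mul_le_mul_of_nonneg_left h1 hηpos.le
      linarith)
  -- Since `k ≤ ψ k`, the subsequence still lies in the sets `C k`.
  exact ⟨fun k => p (ψ k), fun k => hanti (hψ.id_le k) (hpC _), f, hf⟩

end StrictlyConvexMinimization

/-! ### Separation of epigraphs and Cesari's property (Q) -/

section PropertyQ

variable {V E : Type*} [TopologicalSpace V] [NormedAddCommGroup E]

theorem coe_lt_of_forall_epigraph {y : EReal} {q : ℝ} (hbot : y ≠ ⊥)
    (h : ∀ r : ℝ, y ≤ r → q < r) : (q : EReal) < y := by
  induction y with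
  | bot => exact absurd rfl hbot
  | top => exact EReal.coe_lt_top q
  | coe x => exact EReal.coe_lt_coe_iff.2 (h x le_rfl)

/-- Tube lemma: a strict inequality between continuous functions on a compact slice persists on
nearby slices. -/
theorem eventually_lt_of_isCompact {f : V → E → EReal}
    (hf : Continuous fun p : V × E => f p.1 p.2) {u₀ : V} {K : Set E} (hK : IsCompact K)
    {q : E → ℝ} (hq : Continuous q) (h : ∀ η ∈ K, (q η : EReal) < f u₀ η) :
    ∀ᶠ v in 𝓝 u₀, ∀ η ∈ K, (q η : EReal) < f v η := by
  refine hK.eventually_forall_of_forall_eventually fun η hη => ?_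
  have hcq : Continuous fun p : V × E => (q p.2 : EReal) :=
    continuous_coe_real_ereal.comp (hq.comp continuous_snd)
  exact (isOpen_lt hcq hf).mem_nhds (h η hη)

variable [NormedSpace ℝ E]

theorem ExtConvex.le_combo {f : E → EReal} (hf : ExtConvex f) {p q : E} {r s t : ℝ}
    (ht : 0 < t) (ht1 : t < 1) (hp : f p ≤ r) (hq : f q ≤ s) :
    f (t • p + (1 - t) • q) ≤ ((t * r + (1 - t) * s : ℝ) : EReal) := by
  refine (hf p q t ht ht1).trans ?_
  rw [EReal.coe_add, EReal.coe_mul, EReal.coe_mul]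
  refine add_le_add ?_ ?_
  · exact mul_le_mul_of_nonneg_left hp (EReal.coe_nonneg.2 ht.le)
  · exact mul_le_mul_of_nonneg_left hq (EReal.coe_nonneg.2 (by linarith))

variable [FiniteDimensional ℝ E]

/-- For a continuous integrand that is convex and coercive in its second variable, a point outside
the epigraph of `f u₀` can be separated uniformly from the epigraphs of `f v`, `v` near `u₀`. -/
theorem exists_eventually_separation {f : V → E → EReal}
    (hf : Continuous fun p : V × E => f p.1 p.2) (hconv : ∀ v, ExtConvex (f v)) {a c : ℝ}
    (ha : 0 < a) (hlow : ∀ v ξ, ((a * ‖ξ‖ + c : ℝ) : EReal) ≤ f v ξ) {u₀ : V} {w : E × ℝ}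
    (hw : ¬ f u₀ w.1 ≤ w.2) :
    ∃ (Λ : E × ℝ →L[ℝ] ℝ) (γ : ℝ), Λ w < γ ∧
      ∀ᶠ v in 𝓝 u₀, ∀ (η : E) (r : ℝ), f v η ≤ r → γ ≤ Λ (η, r) := by
  have : ProperSpace E := FiniteDimensional.proper ℝ E
  have hlowr : ∀ v η (r : ℝ), f v η ≤ r → a * ‖η‖ + c ≤ r := fun v η r h =>
    EReal.coe_le_coe_iff.1 ((hlow v η).trans h)
  by_cases htop : ∀ ξ, f u₀ ξ = ⊤
  · refine ⟨ContinuousLinearMap.snd ℝ E ℝ, w.2 + 1, by simp, ?_⟩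
    filter_upwards [eventually_lt_of_isCompact (u₀ := u₀) hf
      (isCompact_closedBall (0 : E) ((w.2 + 1 - c) / a)) (q := fun _ => w.2 + 1) continuous_const
      (fun η _ => by rw [htop]; exact EReal.coe_lt_top _)] with v hv η r hr
    change w.2 + 1 ≤ r
    by_cases hη : η ∈ Metric.closedBall (0 : E) ((w.2 + 1 - c) / a)
    · exact (EReal.coe_lt_coe_iff.1 ((hv η hη).trans_le hr)).le
    · rw [mem_closedBall_zero_iff, not_le, div_lt_iff₀ ha] at hη
      have := hlowr v η r hr
      linarith
  push Not at htop
  obtain ⟨ξ₁, hξ₁⟩ := htop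
  obtain ⟨r₁, hr₁, -⟩ := EReal.lt_iff_exists_real_btwn.1 (lt_top_iff_ne_top.2 hξ₁)
  set C : Set (E × ℝ) := {p | f u₀ p.1 ≤ (p.2 : EReal)} with hC
  have hCclosed : IsClosed C := by
    refine isClosed_le ?_ (continuous_coe_real_ereal.comp continuous_snd)
    exact hf.comp (continuous_const.prodMk continuous_fst)
  have hCconv : Convex ℝ C := by
    refine convex_iff_forall_pos.2 fun p hp q hq t s ht hs hts => ?_
    obtain rfl : s = 1 - t := by linarith
    exact (hconv u₀).le_combo ht (by linarith) hp hq
  obtain ⟨g, s, hgw, hgC⟩ := geometric_hahn_banach_point_closed hCconv hCclosed (x := w) hw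
  have hgdec : ∀ η r, g (η, r) = g (η, 0) + r * g (0, 1) := by
    intro η r
    have : ((η, r) : E × ℝ) = (η, 0) + r • (0, 1) := by simp
    rw [this, map_add, map_smul, smul_eq_mul]
  -- The epigraph is unbounded upwards, so a functional bounded below on it cannot decrease in the
  -- vertical direction. The hyperplane may still be vertical.
  have hκ : 0 ≤ g (0, 1) := by
    by_contra hneg
    push Not at hneg
    obtain ⟨n, hn⟩ := exists_nat_gt ((g (ξ₁, r₁) - s) / (- g (0, 1)))
    have hmem : ((ξ₁, r₁ + n) : E × ℝ) ∈ C := by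
      refine hr₁.le.trans (EReal.coe_le_coe_iff.2 ?_)
      simp
    have h1 := hgC _ hmem
    rw [hgdec] at h1
    rw [div_lt_iff₀ (by linarith), hgdec ξ₁ r₁] at hn
    linarith
  -- Tilting `g` by `ε` times the vertical coordinate makes the vertical coefficient positive and,
  -- by coercivity, adds the growth `ε * a * ‖η‖`. The size of `ε` keeps `w` strictly below the new
  -- level `γ`.
  set ε : ℝ := (s - g w) / (2 * (|w.2 - c| + 1)) with hε
  have hεpos : 0 < ε := div_pos (by linarith) (by positivity)
  have hεlt : ε * (w.2 - c) < s - g w := by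
    have h1 : ε * (2 * (|w.2 - c| + 1)) = s - g w := by
      rw [hε]; field_simp
    have h2 := le_abs_self (w.2 - c)
    nlinarith [abs_nonneg (w.2 - c)]
  set Λ : E × ℝ →L[ℝ] ℝ := g + ε • ContinuousLinearMap.snd ℝ E ℝ with hΛ
  have hΛapp : ∀ p, Λ p = g p + ε * p.2 := fun p => by simp [hΛ]
  set γ : ℝ := s + ε * c with hγ
  set k : ℝ := g (0, 1) + ε with hk
  have hkpos : 0 < k := by linarith
  have hΛdec : ∀ η r, Λ (η, r) = g (η, 0) + k * r := by
    intro η r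
    rw [hΛapp, hgdec, hk]; ring
  have hΛC : ∀ η (r : ℝ), f u₀ η ≤ r → γ + ε * a * ‖η‖ < Λ (η, r) := by
    intro η r hr
    have h1 := hgC (η, r) hr
    have h2 := hlowr u₀ η r hr
    rw [hΛapp]
    change s + ε * c + ε * a * ‖η‖ < g (η, r) + ε * r
    nlinarith
  have hbot : ∀ η, f u₀ η ≠ ⊥ := fun η hb => by
    have := hlow u₀ η
    rw [hb, le_bot_iff] at this
    exact EReal.coe_ne_bot _ this
  set K₁ : ℝ := Λ (ξ₁, r₁) with hK₁
  have hγK : γ < K₁ := by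
    have := hΛC ξ₁ r₁ hr₁.le
    have : 0 ≤ ε * a * ‖ξ₁‖ := by positivity
    linarith
  -- On the sphere of radius `R` about `ξ₁` the growth term alone lifts `Λ` above `K₁`, its value at
  -- the reference point `(ξ₁, r₁)`.
  set R : ℝ := ‖ξ₁‖ + (K₁ - γ) / (ε * a) with hR
  have hεa : 0 < ε * a := by positivity
  have hRpos : 0 < R := by
    have : 0 < (K₁ - γ) / (ε * a) := div_pos (by linarith) hεa
    have := norm_nonneg ξ₁
    linarith
  have hball : ∀ η ∈ Metric.closedBall ξ₁ R, (((γ - g (η, 0)) / k : ℝ) : EReal) < f u₀ η := by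
    intro η _
    refine coe_lt_of_forall_epigraph (hbot η) fun r hr => ?_
    have h1 := hΛC η r hr
    rw [hΛdec] at h1
    rw [div_lt_iff₀ hkpos]
    have : 0 ≤ ε * a * ‖η‖ := by positivity
    linarith
  have hsphere : ∀ η ∈ Metric.sphere ξ₁ R, (((K₁ - g (η, 0)) / k : ℝ) : EReal) < f u₀ η := by
    intro η hη
    refine coe_lt_of_forall_epigraph (hbot η) fun r hr => ?_
    have h1 := hΛC η r hr
    rw [hΛdec] at h1
    rw [div_lt_iff₀ hkpos]
    rw [mem_sphere_iff_norm] at hη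
    have h2 : R ≤ ‖η‖ + ‖ξ₁‖ := hη ▸ norm_sub_le η ξ₁
    have h3 : (K₁ - γ) / (ε * a) ≤ ‖η‖ := by linarith
    rw [div_le_iff₀ hεa] at h3
    linarith
  have hgc : Continuous fun η : E => g (η, 0) :=
    g.continuous.comp (continuous_id.prodMk continuous_const)
  refine ⟨Λ, γ, by rw [hΛapp]; linarith, ?_⟩
  have hnear : ∀ᶠ v in 𝓝 u₀, f v ξ₁ < r₁ := by
    have : Continuous fun v => f v ξ₁ := hf.comp (continuous_id.prodMk continuous_const)
    exact (this.tendsto u₀).eventually_lt_const hr₁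
  filter_upwards [hnear,
    eventually_lt_of_isCompact hf (isCompact_closedBall ξ₁ R)
      ((continuous_const.sub hgc).div_const k) hball,
    eventually_lt_of_isCompact hf (isCompact_sphere ξ₁ R)
      ((continuous_const.sub hgc).div_const k) hsphere] with v hv1 hvball hvsphere η r hr
  by_cases hη : η ∈ Metric.closedBall ξ₁ R
  · have h1 := EReal.coe_lt_coe_iff.1 ((hvball η hη).trans_le hr)
    rw [div_lt_iff₀ hkpos] at h1
    change γ - g (η, 0) < r * k at h1
    rw [hΛdec]
    linarith
  -- Outside the ball only convexity of `f v` is used: the segment from `(ξ₁, r₁)`, where `Λ = K₁`,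
  -- to `(η, r)` stays in the epigraph of `f v` and crosses the sphere where `Λ > K₁`. As `Λ` is
  -- affine along it, `Λ (η, r) > K₁ > γ`.
  · rw [mem_closedBall_iff_norm, not_le] at hη
    set t : ℝ := R / ‖η - ξ₁‖ with ht
    have ht0 : 0 < t := div_pos hRpos (hRpos.trans hη)
    have ht1 : t < 1 := (div_lt_one (hRpos.trans hη)).2 hη
    have hmem : t • η + (1 - t) • ξ₁ ∈ Metric.sphere ξ₁ R := by
      rw [mem_sphere_iff_norm]
      have : t • η + (1 - t) • ξ₁ - ξ₁ = t • (η - ξ₁) := by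
        rw [sub_smul, one_smul, smul_sub]; abel
      rw [this, norm_smul, Real.norm_of_nonneg ht0.le, ht,
        div_mul_cancel₀ _ (hRpos.trans hη).ne']
    have h1 := EReal.coe_lt_coe_iff.1
      ((hvsphere _ hmem).trans_le ((hconv v).le_combo ht0 ht1 hr hv1.le))
    rw [div_lt_iff₀ hkpos] at h1
    have h2 : Λ (t • η + (1 - t) • ξ₁, t * r + (1 - t) * r₁)
        = t * Λ (η, r) + (1 - t) * K₁ := by
      have : ((t • η + (1 - t) • ξ₁, t * r + (1 - t) * r₁) : E × ℝ)
        = t • (η, r) + (1 - t) • (ξ₁, r₁) := rfl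
      rw [this, map_add, map_smul, map_smul, smul_eq_mul, smul_eq_mul]
    rw [hΛdec] at h2
    change K₁ - g (t • η + (1 - t) • ξ₁, 0) < _ at h1
    have h3 : t * K₁ < t * Λ (η, r) := by linarith
    have h4 : K₁ < Λ (η, r) := lt_of_mul_lt_mul_left h3 ht0.le
    linarith

/-- Limits of forward convex combinations of points of the epigraphs of `f (u m)`, where
`u m → u₀`, lie in the epigraph of `f u₀`. -/
theorem le_of_tendsto_convexHull {f : V → E → EReal}
    (hf : Continuous fun p : V × E => f p.1 p.2) (hconv : ∀ v, ExtConvex (f v)) {a c : ℝ}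
    (ha : 0 < a) (hlow : ∀ v ξ, ((a * ‖ξ‖ + c : ℝ) : EReal) ≤ f v ξ) {u : ℕ → V} {u₀ : V}
    (hu : Tendsto u atTop (𝓝 u₀)) {z : ℕ → E × ℝ} (hz : ∀ m, f (u m) (z m).1 ≤ (z m).2)
    {w : ℕ → E × ℝ} (hw : ∀ n, w n ∈ convexHull ℝ (z '' Ici n)) {w₀ : E × ℝ}
    (hlim : Tendsto w atTop (𝓝 w₀)) : f u₀ w₀.1 ≤ w₀.2 := by
  by_contra hcon
  obtain ⟨Λ, γ, hΛ, hev⟩ := exists_eventually_separation hf hconv ha hlow hcon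
  obtain ⟨n₀, hn₀⟩ := eventually_atTop.1 (hu.eventually hev)
  refine hΛ.not_ge (ge_of_tendsto ((Λ.continuous.tendsto w₀).comp hlim) ?_)
  filter_upwards [eventually_ge_atTop n₀] with n hn
  have hsub : convexHull ℝ (z '' Ici n) ⊆ {p | γ ≤ Λ p} := by
    refine convexHull_min ?_ (convex_halfSpace_ge Λ.isLinear γ)
    rintro _ ⟨m, hm, rfl⟩
    exact hn₀ m (hn.trans hm) _ _ (hz m)
  exact hsub (hw n)

end PropertyQ

/-! ### The closure of the test functions: Poincaré and Rellich -/

section TestFunctions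

variable {d N : ℕ} {Ω : Set (Vec d)}

theorem IsTestFunction.differentiable {F : Type*} [NormedAddCommGroup F] [NormedSpace ℝ F]
    {φ : Vec d → F} (h : IsTestFunction Ω φ) : Differentiable ℝ φ :=
  h.smooth.differentiable (by simp)

theorem IsTestFunction.memLp {φ : Vec d → Vec N} (h : IsTestFunction Ω φ) :
    MemLp φ 1 (volume.restrict Ω) :=
  memLp_one_iff_integrable.2
    (h.smooth.continuous.integrable_of_hasCompactSupport h.compact).restrict

theorem IsTestFunction.memLp_pderiv {φ : Vec d → Vec N} (h : IsTestFunction Ω φ) (i : Fin d) :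
    MemLp (pderiv i φ) 1 (volume.restrict Ω) :=
  memLp_one_iff_integrable.2
    ((h.continuous_pderiv i).integrable_of_hasCompactSupport
      (h.compact.fderiv_apply ℝ _)).restrict

theorem norm_le_sum_norm_apply_single {F : Type*} [NormedAddCommGroup F] [NormedSpace ℝ F]
    (A : Vec d →L[ℝ] F) : ‖A‖ ≤ ∑ i, ‖A (EuclideanSpace.single i 1)‖ := by
  refine A.opNorm_le_bound (Finset.sum_nonneg fun _ _ => norm_nonneg _) fun x => ?_
  have hx : x = ∑ i, x i • EuclideanSpace.single i (1 : ℝ) := by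
    ext j
    simp [Finset.sum_apply, Pi.single_apply]
  conv_lhs => rw [hx, map_sum]
  rw [Finset.sum_mul]
  refine (norm_sum_le _ _).trans (Finset.sum_le_sum fun i _ => ?_)
  rw [map_smul, norm_smul, mul_comm]
  exact mul_le_mul_of_nonneg_left (PiLp.norm_apply_le x i) (norm_nonneg _)

/-- The pairs `(φ, (∂₁φ, …, ∂_dφ))` with `φ ∈ C_c^∞(Ω; ℝ^N)`. -/
noncomputable def testSubmodule (Ω : Set (Vec d)) (N : ℕ) :
    Submodule ℝ (LOne Ω N × (Fin d → LOne Ω N)) where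
  carrier := {p | ∃ φ : Vec d → Vec N, IsTestFunction Ω φ ∧ p.1 =ᵐ[volume.restrict Ω] φ ∧
    ∀ i, p.2 i =ᵐ[volume.restrict Ω] pderiv i φ}
  zero_mem' := by
    refine ⟨0, ⟨contDiff_const, HasCompactSupport.zero, by simp [tsupport]⟩,
      Lp.coeFn_zero _ _ _, fun i => ?_⟩
    have : pderiv i (0 : Vec d → Vec N) = 0 := by
      funext x
      simp [pderiv]
    rw [this]
    exact Lp.coeFn_zero _ _ _
  add_mem' := by
    rintro p q ⟨φ, hφ, hp, hp'⟩ ⟨ψ, hψ, hq, hq'⟩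
    refine ⟨φ + ψ, ⟨hφ.smooth.add hψ.smooth, hφ.compact.add hψ.compact,
      (tsupport_add φ ψ).trans (union_subset hφ.support hψ.support)⟩,
      (Lp.coeFn_add _ _).trans (hp.add hq), fun i => ?_⟩
    have : pderiv i (φ + ψ) = pderiv i φ + pderiv i ψ := by
      funext x
      simp [pderiv, fderiv_add (hφ.differentiable x) (hψ.differentiable x)]
    rw [this]
    exact (Lp.coeFn_add _ _).trans ((hp' i).add (hq' i))
  smul_mem' := by
    rintro r p ⟨φ, hφ, hp, hp'⟩
    refine ⟨r • φ, ⟨contDiff_const.smul hφ.smooth, hφ.compact.smul_left (f := fun _ => r),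
      (tsupport_smul_subset_right (fun _ => r) φ).trans hφ.support⟩,
      (Lp.coeFn_smul _ _).trans (hp.const_smul r), fun i => ?_⟩
    have : pderiv i (r • φ) = r • pderiv i φ := by
      funext x
      simp [pderiv, fderiv_const_smul (hφ.differentiable x)]
    rw [this]
    exact (Lp.coeFn_smul _ _).trans ((hp' i).const_smul r)

theorem norm_sub_eq_integral {f p : LOne Ω N} {g : Vec d → Vec N}
    (h : p =ᵐ[volume.restrict Ω] g) : ‖f - p‖ = ∫ x in Ω, ‖f x - g x‖ := by
  rw [L1.norm_eq_integral_norm]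
  refine integral_congr_ae ?_
  filter_upwards [Lp.coeFn_sub f p, h] with x h1 h2
  rw [h1, Pi.sub_apply, h2]

/-- The definition uses the sum of the `L¹` norms and the product space their maximum; these are
equivalent, with factor `d + 1`. Zero boundary values thereby become membership in a closed
subspace. -/
theorem isZeroBoundary_iff {v : W11 Ω N} :
    IsZeroBoundary v ↔ v.1 ∈ (testSubmodule Ω N).topologicalClosure := by
  rw [← SetLike.mem_coe, Submodule.topologicalClosure_coe, Metric.mem_closure_iff]
  constructor
  · intro h ε hε
    obtain ⟨φ, hφ, hlt⟩ := h ε hε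
    set q : LOne Ω N × (Fin d → LOne Ω N) :=
      (hφ.memLp.toLp φ, fun i => (hφ.memLp_pderiv i).toLp _) with hq
    have h1 := norm_sub_eq_integral (f := fn v) hφ.memLp.coeFn_toLp
    have h2 := fun i => norm_sub_eq_integral (f := weakD v i) (hφ.memLp_pderiv i).coeFn_toLp
    refine ⟨q, ⟨φ, hφ, hφ.memLp.coeFn_toLp, fun i => (hφ.memLp_pderiv i).coeFn_toLp⟩, ?_⟩
    rw [← h1] at hlt
    simp only [← h2] at hlt
    have hs : 0 ≤ ∑ i, ‖weakD v i - (hφ.memLp_pderiv i).toLp _‖ :=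
      Finset.sum_nonneg fun _ _ => norm_nonneg _
    rw [dist_eq_norm, Prod.norm_def]
    refine max_lt ?_ ?_
    · change ‖fn v - hφ.memLp.toLp φ‖ < ε
      linarith
    · refine (pi_norm_lt_iff hε).2 fun i => ?_
      change ‖weakD v i - (hφ.memLp_pderiv i).toLp _‖ < ε
      have := Finset.single_le_sum (f := fun i => ‖weakD v i - (hφ.memLp_pderiv i).toLp _‖)
        (fun _ _ => norm_nonneg _) (Finset.mem_univ i)
      have := norm_nonneg (fn v - hφ.memLp.toLp φ)
      linarith
  · intro h ε hε
    obtain ⟨q, ⟨φ, hφ, hq1, hq2⟩, hlt⟩ := h (ε / (d + 1)) (by positivity)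
    refine ⟨φ, hφ, ?_⟩
    rw [← norm_sub_eq_integral hq1]
    simp only [← norm_sub_eq_integral (hq2 _)]
    rw [dist_eq_norm] at hlt
    have h1 : ‖fn v - q.1‖ ≤ ‖v.1 - q‖ := norm_fst_le (v.1 - q)
    have h2 : ∀ i, ‖weakD v i - q.2 i‖ ≤ ‖v.1 - q‖ := fun i =>
      (norm_le_pi_norm (v.1 - q).2 i).trans (norm_snd_le (v.1 - q))
    have h3 : ∑ i, ‖weakD v i - q.2 i‖ ≤ d * ‖v.1 - q‖ := by
      refine (Finset.sum_le_card_nsmul _ _ _ fun i _ => h2 i).trans_eq ?_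
      simp
    rw [lt_div_iff₀ (by positivity)] at hlt
    linarith

theorem lintegral_enorm_coeFn (f : LOne Ω N) :
    ∫⁻ x in Ω, ‖f x‖ₑ = ENNReal.ofReal ‖f‖ := by
  rw [L1.norm_eq_integral_norm,
    ofReal_integral_norm_eq_lintegral_enorm (L1.integrable_coeFn f)]

/-- The derivative of a test function vanishes off Ω, so estimates on the whole space can be fed
with norms on Ω. -/
theorem lintegral_enorm_fderiv_le (hΩ : IsOpen Ω) {φ : Vec d → Vec N} (hφ : IsTestFunction Ω φ)
    {g : Fin d → LOne Ω N} (hg : ∀ i, g i =ᵐ[volume.restrict Ω] pderiv i φ) :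
    ∫⁻ x, ‖fderiv ℝ φ x‖ₑ ≤ ENNReal.ofReal (∑ i, ‖g i‖) := by
  have h1 : ∫⁻ x, ‖fderiv ℝ φ x‖ₑ = ∫⁻ x in Ω, ‖fderiv ℝ φ x‖ₑ := by
    rw [← lintegral_indicator hΩ.measurableSet]
    refine lintegral_congr fun x => ?_
    by_cases hx : x ∈ Ω
    · rw [indicator_of_mem hx]
    · rw [indicator_of_notMem hx]
      have : fderiv ℝ φ x = 0 := by
        by_contra hne
        exact hx (hφ.support (support_fderiv_subset ℝ hne))
      rw [this, ← ofReal_norm, norm_zero, ENNReal.ofReal_zero]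
  rw [h1, ENNReal.ofReal_sum_of_nonneg fun _ _ => norm_nonneg _]
  simp only [← lintegral_enorm_coeFn]
  rw [← lintegral_finsetSum' _ fun i _ => (Lp.aestronglyMeasurable (g i)).enorm]
  refine lintegral_mono_ae ?_
  filter_upwards [ae_all_iff.2 hg] with x hx
  simp only [hx, ← ofReal_norm]
  rw [← ENNReal.ofReal_sum_of_nonneg fun _ _ => norm_nonneg _]
  exact ENNReal.ofReal_le_ofReal (norm_le_sum_norm_apply_single _)

/-- Test functions satisfy the Poincaré inequality on a bounded set. -/
theorem exists_poincare (hd : 1 ≤ d) (hΩ : IsOpen Ω) (hb : Bornology.IsBounded Ω) :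
    ∃ K : ℝ, 0 ≤ K ∧ ∀ p ∈ (testSubmodule Ω N).topologicalClosure,
      ‖p.1‖ ≤ K * ∑ i, ‖p.2 i‖ := by
  obtain ⟨R, hRpos, hR⟩ := hb.subset_ball_lt 0 0
  have : Nonempty (Fin d) := ⟨⟨0, hd⟩⟩
  refine ⟨2 * R, by positivity, fun p hp => ?_⟩
  have hcl : IsClosed {p : LOne Ω N × (Fin d → LOne Ω N) | ‖p.1‖ ≤ 2 * R * ∑ i, ‖p.2 i‖} := by
    refine isClosed_le (by fun_prop) (by fun_prop)
  refine closure_minimal ?_ hcl hp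
  rintro q ⟨φ, hφ, hq1, hq2⟩
  have h1 := lintegral_enorm_le_mul_lintegral_fderiv (μ := (volume : Measure (Vec d)))
    (hφ.smooth.of_le (by simp)) (((subset_tsupport φ).trans hφ.support).trans hR)
  have h2 : ENNReal.ofReal ‖q.1‖ ≤ ∫⁻ x, ‖φ x‖ₑ := by
    rw [← lintegral_enorm_coeFn]
    refine le_trans (le_of_eq (lintegral_congr_ae ?_)) (setLIntegral_le_lintegral Ω _)
    filter_upwards [hq1] with x hx
    rw [hx]
  have h3 := (h2.trans h1).trans (mul_le_mul_right (lintegral_enorm_fderiv_le hΩ hφ hq2) _)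
  rw [← ENNReal.ofReal_mul (by positivity)] at h3
  exact (ENNReal.ofReal_le_ofReal_iff
    (mul_nonneg (by positivity) (Finset.sum_nonneg fun _ _ => norm_nonneg _))).1 h3

/-- Rellich's theorem for `W_0^{1,1}` of a bounded open set. -/
theorem exists_subseq_tendsto_of_bounded (hd : 1 ≤ d) (hΩ : IsOpen Ω)
    (hb : Bornology.IsBounded Ω) {p : ℕ → LOne Ω N × (Fin d → LOne Ω N)}
    (hp : ∀ n, p n ∈ (testSubmodule Ω N).topologicalClosure) {M : ℝ}
    (hM : ∀ n, ∑ i, ‖(p n).2 i‖ ≤ M) :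
    ∃ f : LOne Ω N, ∃ ψ : ℕ → ℕ, StrictMono ψ ∧
      Tendsto (fun n => (p (ψ n)).1) atTop (𝓝 f) := by
  obtain ⟨K, hK, hpoin⟩ := exists_poincare (N := N) hd hΩ hb
  -- Test functions at distance tending to zero from `p n` have the same `L¹` limits, and smooth
  -- estimates apply to them.
  have happrox : ∀ n : ℕ, ∃ q ∈ testSubmodule Ω N, dist (p n) q < 1 / ((n : ℝ) + 1) := fun n =>
    Metric.mem_closure_iff.1 (hp n) _ (by positivity)
  choose q hq hpq using happrox
  have hqM : ∀ n, ∑ i, ‖(q n).2 i‖ ≤ M + d := by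
    intro n
    have h1 : ∀ i, ‖(q n).2 i‖ ≤ ‖(p n).2 i‖ + 1 := by
      intro i
      have h2 : dist ((p n).2 i) ((q n).2 i) ≤ 1 := by
        refine (dist_le_pi_dist _ _ i).trans ((le_max_right _ _).trans ((hpq n).le.trans ?_))
        rw [div_le_one (by positivity)]
        linarith [Nat.cast_nonneg (α := ℝ) n]
      have h3 := norm_le_norm_add_norm_sub' ((q n).2 i) ((p n).2 i)
      rw [dist_comm, dist_eq_norm] at h2
      linarith
    refine (Finset.sum_le_sum fun i _ => h1 i).trans ?_
    rw [Finset.sum_add_distrib]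
    simpa using hM n
  choose φ hφ hφ1 hφ2 using hq
  have hφint : ∀ n, Integrable (φ n) := fun n =>
    (hφ n).smooth.continuous.integrable_of_hasCompactSupport (hφ n).compact
  have hφB : ∀ n, ∫ x, ‖φ n x‖ ≤ K * (M + d) := by
    intro n
    have h1 : ∫ x, ‖φ n x‖ = ‖(q n).1‖ := by
      rw [L1.norm_eq_integral_norm, ← setIntegral_eq_integral_of_forall_compl_eq_zero (s := Ω)]
      · refine integral_congr_ae ?_
        filter_upwards [hφ1 n] with x hx
        rw [hx]
      · intro x hx
        rw [norm_eq_zero]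
        by_contra hne
        exact hx ((hφ n).support (subset_tsupport _ hne))
    rw [h1]
    refine (hpoin _ (Submodule.le_topologicalClosure _ ⟨φ n, hφ n, hφ1 n, hφ2 n⟩)).trans ?_
    exact mul_le_mul_of_nonneg_left (hqM n) hK
  have hTB : TotallyBounded (range fun n => (q n).1) := by
    refine Metric.totallyBounded_iff.2 fun ε hε => ?_
    obtain ⟨t, htfin, ht⟩ := exists_finite_net_of_lintegral_fderiv_le (μ := volume) (G := M + d)
      (fun n => (hφ n).smooth.of_le (by simp)) hφint hφB
      (fun n => (lintegral_enorm_fderiv_le hΩ (hφ n) (hφ2 n)).trans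
        (ENNReal.ofReal_le_ofReal (hqM n))) hb (half_pos hε)
    refine ⟨(fun n => (q n).1) '' t, htfin.image _, ?_⟩
    rintro _ ⟨n, rfl⟩
    obtain ⟨m, hmt, hm⟩ := ht n
    refine mem_iUnion₂.2 ⟨_, mem_image_of_mem _ hmt, ?_⟩
    rw [Metric.mem_ball, dist_eq_norm]
    have h1 : ENNReal.ofReal ‖(q n).1 - (q m).1‖ ≤ ENNReal.ofReal (ε / 2) := by
      rw [← lintegral_enorm_coeFn]
      refine le_trans (le_of_eq (lintegral_congr_ae ?_)) hm
      filter_upwards [Lp.coeFn_sub (q n).1 (q m).1, hφ1 n, hφ1 m] with x h1 h2 h3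
      rw [h1, Pi.sub_apply, h2, h3]
    have := (ENNReal.ofReal_le_ofReal_iff (by positivity)).1 h1
    linarith
  have hcomp : IsCompact (closure (range fun n => (q n).1)) :=
    hTB.closure.isCompact_of_isClosed isClosed_closure
  obtain ⟨f, -, ψ, hψ, hlim⟩ := hcomp.tendsto_subseq
    (x := fun n => (q n).1) fun n => subset_closure (mem_range_self n)
  refine ⟨f, ψ, hψ, ?_⟩
  have hdist : Tendsto (fun n => dist (q (ψ n)).1 (p (ψ n)).1) atTop (𝓝 0) := by
    refine squeeze_zero (fun _ => dist_nonneg) (fun n => ?_)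
      (tendsto_one_div_add_atTop_nhds_zero_nat.comp hψ.tendsto_atTop)
    rw [dist_comm]
    exact (le_max_left _ _).trans (hpq (ψ n)).le
  exact (tendsto_iff_of_dist hdist).1 hlim

end TestFunctions

/-! ### Closedness of the Sobolev space -/

section Closed

variable {d N : ℕ} {Ω : Set (Vec d)}

theorem continuous_integral_smul {g : Vec d → ℝ} (hg : Continuous g) {C : ℝ}
    (hC : ∀ x, ‖g x‖ ≤ C) : Continuous fun f : LOne Ω N => ∫ x in Ω, g x • f x := by
  have hi : ∀ f : LOne Ω N, Integrable (fun x => g x • f x) (volume.restrict Ω) := fun f =>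
    (L1.integrable_coeFn f).bdd_smul C hg.aestronglyMeasurable (Eventually.of_forall hC)
  have hC0 : 0 ≤ C := (norm_nonneg _).trans (hC 0)
  refine (LipschitzWith.of_dist_le_mul (K := ⟨C, hC0⟩) fun f f' => ?_).continuous
  rw [dist_eq_norm, dist_eq_norm, ← integral_sub (hi f) (hi f'), L1.norm_eq_integral_norm]
  change _ ≤ C * _
  rw [← integral_const_mul]
  refine norm_integral_le_of_norm_le ((L1.integrable_coeFn _).norm.const_mul C) ?_
  filter_upwards [Lp.coeFn_sub f f'] with x hx
  rw [hx, ← smul_sub, norm_smul]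
  exact mul_le_mul_of_nonneg_right (hC x) (norm_nonneg _)

/-- For a fixed test function both sides of the weak derivative identity are `L¹`-continuous, so
each identity is a closed condition. Hence joint `L¹` limits of functions and derivatives are
Sobolev functions. -/
theorem isClosed_W11 :
    IsClosed ((W11 Ω N : Submodule ℝ (LOne Ω N × (Fin d → LOne Ω N))) :
      Set (LOne Ω N × (Fin d → LOne Ω N))) := by
  have : ((W11 Ω N : Submodule ℝ (LOne Ω N × (Fin d → LOne Ω N))) :
      Set (LOne Ω N × (Fin d → LOne Ω N))) = ⋂ (i : Fin d), ⋂ (φ : Vec d → ℝ),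
        ⋂ (_ : IsTestFunction Ω φ), {p | ∫ x in Ω, pderiv i φ x • p.1 x
          = - ∫ x in Ω, φ x • p.2 i x} := by
    ext p
    simp only [mem_iInter]
    rfl
  rw [this]
  refine isClosed_iInter fun i => isClosed_iInter fun φ => isClosed_iInter fun hφ => ?_
  obtain ⟨C, hC⟩ := hφ.compact.exists_bound_of_continuous hφ.smooth.continuous
  obtain ⟨C', hC'⟩ := HasCompactSupport.exists_bound_of_continuous (f := pderiv i φ)
    (hφ.compact.fderiv_apply ℝ _) (hφ.continuous_pderiv i)
  refine isClosed_eq ?_ ?_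
  · exact (continuous_integral_smul (hφ.continuous_pderiv i) hC').comp continuous_fst
  · exact ((continuous_integral_smul hφ.smooth.continuous hC).comp
      ((continuous_apply i).comp continuous_snd)).neg

end Closed

/-! ### Linear combinations, gradients and the affine class -/

section Gradient

variable {d N : ℕ} {Ω : Set (Vec d)}

theorem fn_combo (t s : ℝ) (u v : W11 Ω N) :
    fn (t • u + s • v) =ᵐ[volume.restrict Ω] fun x => t • fn u x + s • fn v x := by
  filter_upwards [Lp.coeFn_add (t • fn u) (s • fn v), Lp.coeFn_smul t (fn u),
    Lp.coeFn_smul s (fn v)] with x h1 h2 h3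
  change (t • fn u + s • fn v : LOne Ω N) x = _
  rw [h1, Pi.add_apply, h2, h3]
  rfl

theorem grad_combo (t s : ℝ) (u v : W11 Ω N) :
    grad (t • u + s • v) =ᵐ[volume.restrict Ω] fun x => t • grad u x + s • grad v x := by
  have h : ∀ i, weakD (t • u + s • v) i =ᵐ[volume.restrict Ω]
      fun x => t • weakD u i x + s • weakD v i x := by
    intro i
    filter_upwards [Lp.coeFn_add (t • weakD u i) (s • weakD v i), Lp.coeFn_smul t (weakD u i),
      Lp.coeFn_smul s (weakD v i)] with x h1 h2 h3
    change (t • weakD u i + s • weakD v i : LOne Ω N) x = _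
    rw [h1, Pi.add_apply, h2, h3]
    rfl
  filter_upwards [ae_all_iff.2 h] with x hx
  ext p
  simp only [PiLp.add_apply, PiLp.smul_apply, grad_apply, hx]

theorem norm_grad_le_sum (u : W11 Ω N) (x : Vec d) : ‖grad u x‖ ≤ ∑ i, ‖weakD u i x‖ := by
  refine le_of_sq_le_sq ?_ (Finset.sum_nonneg fun _ _ => norm_nonneg _)
  have h1 : ‖grad u x‖ ^ 2 = ∑ i, ‖weakD u i x‖ ^ 2 := by
    simp only [EuclideanSpace.norm_sq_eq]
    rw [Fintype.sum_prod_type, Finset.sum_comm]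
    rfl
  rw [h1]
  exact Finset.sum_sq_le_sq_sum_of_nonneg fun i _ => norm_nonneg _

theorem integrable_grad (u : W11 Ω N) : Integrable (grad u) (volume.restrict Ω) :=
  (integrable_finsetSum Finset.univ fun i _ =>
    (L1.integrable_coeFn (weakD u i)).norm).mono' (aestronglyMeasurable_grad u)
    (Eventually.of_forall (norm_grad_le_sum u))

theorem mem_affineClass_iff {u u₀ : W11 Ω N} :
    u ∈ affineClass u₀ ↔ u.1 - u₀.1 ∈ (testSubmodule Ω N).topologicalClosure :=
  isZeroBoundary_iff

theorem self_mem_affineClass (u₀ : W11 Ω N) : u₀ ∈ affineClass u₀ := by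
  rw [mem_affineClass_iff, sub_self]
  exact zero_mem _

theorem convex_affineClass (u₀ : W11 Ω N) : Convex ℝ (affineClass u₀) := by
  intro u hu v hv t s ht hs hts
  rw [mem_affineClass_iff] at *
  have : (t • u + s • v : W11 Ω N).1 - u₀.1 = t • (u.1 - u₀.1) + s • (v.1 - u₀.1) := by
    change t • u.1 + s • v.1 - u₀.1 = _
    have h : u₀.1 = (t + s) • u₀.1 := by rw [hts, one_smul]
    conv_lhs => rw [h]
    rw [add_smul, smul_sub, smul_sub]
    abel
  rw [this]
  exact add_mem (Submodule.smul_mem _ _ hu) (Submodule.smul_mem _ _ hv)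

end Gradient

/-! ### Coercivity and boundedness of minimizing sequences -/

section Bounds

variable {d N : ℕ} {Ω : Set (Vec d)} {L : Vec d → Vec N → Mat N d → EReal} {a : ℝ} {c : Vec d → ℝ}

/-- The integrable minorant `c` excludes `∞ - ∞`, so finite energy forces a real integrable density;
energies can then be compared as real integrals. -/
theorem exists_density_of_energy_lt_top (hL : IsCaratheodory Ω L) (ha : 0 < a)
    (hc : IntegrableOn c Ω)
    (hlower : ∀ᵐ x ∂(volume.restrict Ω), ∀ (u : Vec N) (ξ : Mat N d),
      ((a * ‖ξ‖ + c x : ℝ) : EReal) ≤ L x u ξ) {u : W11 Ω N} (hu : energy L u < ⊤) :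
    ∃ h : Vec d → ℝ, Integrable h (volume.restrict Ω) ∧
      (∀ᵐ x ∂(volume.restrict Ω), L x (fn u x) (grad u x) = h x) ∧
      energy L u = ((∫ x in Ω, h x : ℝ) : EReal) ∧
      ∀ᵐ x ∂(volume.restrict Ω), a * ‖grad u x‖ + c x ≤ h x := by
  obtain ⟨h, hint, heq⟩ := exists_integrable_of_extIntegral_lt_top
    (aemeasurable_energy_density hL u) (c := c) hc (by
      filter_upwards [hlower] with x hx
      refine le_trans (EReal.coe_le_coe_iff.2 ?_) (hx (fn u x) (grad u x))
      have : 0 ≤ a * ‖grad u x‖ := by positivity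
      linarith) hu
  refine ⟨h, hint, heq, (extIntegral_congr heq).trans (extIntegral_coe hint), ?_⟩
  filter_upwards [heq, hlower] with x h1 h2
  have := h2 (fn u x) (grad u x)
  rw [h1] at this
  exact EReal.coe_le_coe_iff.1 this

theorem coe_integral_le_energy (ha : 0 < a) (hc : IntegrableOn c Ω)
    (hlower : ∀ᵐ x ∂(volume.restrict Ω), ∀ (u : Vec N) (ξ : Mat N d),
      ((a * ‖ξ‖ + c x : ℝ) : EReal) ≤ L x u ξ) (u : W11 Ω N) :
    ((∫ x in Ω, c x : ℝ) : EReal) ≤ energy L u := by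
  rw [← extIntegral_coe hc]
  refine extIntegral_mono ?_
  filter_upwards [hlower] with x hx
  refine le_trans (EReal.coe_le_coe_iff.2 ?_) (hx (fn u x) (grad u x))
  have : 0 ≤ a * ‖grad u x‖ := by positivity
  linarith

/-- The weak derivatives are controlled by the energy. -/
theorem norm_weakD_le (ha : 0 < a) (hc : IntegrableOn c Ω) {u : W11 Ω N} {h : Vec d → ℝ}
    (hint : Integrable h (volume.restrict Ω))
    (hle : ∀ᵐ x ∂(volume.restrict Ω), a * ‖grad u x‖ + c x ≤ h x) (i : Fin d) :
    ‖weakD u i‖ ≤ ((∫ x in Ω, h x) - ∫ x in Ω, c x) / a := by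
  rw [le_div_iff₀ ha, L1.norm_eq_integral_norm, ← integral_sub hint hc, ← integral_mul_const]
  refine integral_mono_ae ((L1.integrable_coeFn _).norm.mul_const a) (hint.sub hc) ?_
  filter_upwards [hle] with x hx
  have := mul_le_mul_of_nonneg_left (norm_weakD_le_norm_grad u i x) ha.le
  linarith

theorem exists_iInf_energy_eq_coe (ha : 0 < a) (hc : IntegrableOn c Ω)
    (hlower : ∀ᵐ x ∂(volume.restrict Ω), ∀ (u : Vec N) (ξ : Mat N d),
      ((a * ‖ξ‖ + c x : ℝ) : EReal) ≤ L x u ξ) {u₀ : W11 Ω N} (hu₀ : energy L u₀ ≠ ⊤) :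
    ∃ I : ℝ, ⨅ v ∈ affineClass u₀, energy L v = (I : EReal) := by
  have h1 : ⨅ v ∈ affineClass u₀, energy L v < ⊤ :=
    (iInf₂_le u₀ (self_mem_affineClass u₀)).trans_lt (lt_top_iff_ne_top.2 hu₀)
  have h2 : ((∫ x in Ω, c x : ℝ) : EReal) ≤ ⨅ v ∈ affineClass u₀, energy L v :=
    le_iInf₂ fun v _ => coe_integral_le_energy ha hc hlower v
  refine ⟨(⨅ v ∈ affineClass u₀, energy L v).toReal, (EReal.coe_toReal h1.ne ?_).symm⟩
  exact ((EReal.bot_lt_coe _).trans_le h2).ne'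

theorem exists_sobolevNorm_le (hd : 1 ≤ d) (hΩ : IsOpen Ω) (hb : Bornology.IsBounded Ω)
    (hL : IsCaratheodory Ω L) (ha : 0 < a) (hc : IntegrableOn c Ω)
    (hlower : ∀ᵐ x ∂(volume.restrict Ω), ∀ (u : Vec N) (ξ : Mat N d),
      ((a * ‖ξ‖ + c x : ℝ) : EReal) ≤ L x u ξ) {u₀ : W11 Ω N} (hu₀ : energy L u₀ ≠ ⊤)
    {u : ℕ → W11 Ω N} (hu : IsMinimizingSeq (energy L) (affineClass u₀) u) :
    ∃ M : ℝ, 0 < M ∧ ∀ n, sobolevNorm (u n) ≤ M := by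
  obtain ⟨I, hI⟩ := exists_iInf_energy_eq_coe ha hc hlower hu₀
  obtain ⟨K, hK, hpoin⟩ := exists_poincare (N := N) hd hΩ hb
  have htend := hu.2
  rw [hI] at htend
  obtain ⟨n₀, hn₀⟩ := eventually_atTop.1
    (htend.eventually_lt_const (EReal.coe_lt_coe_iff.2 (lt_add_one I)))
  set G : ℝ := d * ((I + 1 - ∫ x in Ω, c x) / a) with hG
  set D₀ : ℝ := ∑ i, ‖weakD u₀ i‖ with hD₀
  have hbound : ∀ n ≥ n₀, sobolevNorm (u n) ≤ ‖fn u₀‖ + K * (G + D₀) + G := by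
    intro n hn
    obtain ⟨h, hint, -, hen, hle⟩ := exists_density_of_energy_lt_top hL ha hc hlower
      ((hn₀ n hn).trans (EReal.coe_lt_top _))
    have h1 : ∫ x in Ω, h x < I + 1 := by
      have := hn₀ n hn
      rw [hen] at this
      exact EReal.coe_lt_coe_iff.1 this
    have h2 : ∑ i, ‖weakD (u n) i‖ ≤ G := by
      refine (Finset.sum_le_card_nsmul _ _ ((I + 1 - ∫ x in Ω, c x) / a) fun i _ => ?_).trans_eq
        (by simp [hG])
      refine (norm_weakD_le ha hc hint hle i).trans ?_
      gcongr
    have h3 := hpoin _ (mem_affineClass_iff.1 (hu.1 n))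
    change ‖fn (u n) - fn u₀‖ ≤ K * ∑ i, ‖weakD (u n) i - weakD u₀ i‖ at h3
    have h4 : ∑ i, ‖weakD (u n) i - weakD u₀ i‖ ≤ G + D₀ := by
      refine (Finset.sum_le_sum fun i _ => norm_sub_le _ _).trans ?_
      rw [Finset.sum_add_distrib]
      linarith
    have h5 := mul_le_mul_of_nonneg_left h4 hK
    have h6 := norm_le_norm_add_norm_sub' (fn (u n)) (fn u₀)
    unfold sobolevNorm
    linarith
  have hnn : ∀ v : W11 Ω N, 0 ≤ sobolevNorm v := fun v =>
    add_nonneg (norm_nonneg _) (Finset.sum_nonneg fun _ _ => norm_nonneg _)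
  have hS : 0 ≤ ∑ k ∈ Finset.range n₀, sobolevNorm (u k) := Finset.sum_nonneg fun k _ => hnn _
  -- Before `n₀` the energy may be infinite and gives no bound; those finitely many norms are simply
  -- added.
  refine ⟨|‖fn u₀‖ + K * (G + D₀) + G| + ∑ k ∈ Finset.range n₀, sobolevNorm (u k) + 1,
    by positivity, fun n => ?_⟩
  have habs := abs_nonneg (‖fn u₀‖ + K * (G + D₀) + G)
  rcases le_or_gt n₀ n with hn | hn
  · linarith [hbound n hn, le_abs_self (‖fn u₀‖ + K * (G + D₀) + G)]
  · have := Finset.single_le_sum (f := fun k => sobolevNorm (u k)) (fun k _ => hnn _)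
      (Finset.mem_range.2 hn)
    linarith

end Bounds

/-! ### Uniqueness by strict convexity at the midpoint -/

section Uniqueness

variable {d N : ℕ} {Ω : Set (Vec d)} {L : Vec d → Vec N → Mat N d → EReal} {a : ℝ} {c : Vec d → ℝ}

theorem IsMinimizer.eq_of_extStrictConvex (hΩ : IsOpen Ω)
    (hL : IsCaratheodory Ω L) (ha : 0 < a) (hc : IntegrableOn c Ω)
    (hlower : ∀ᵐ x ∂(volume.restrict Ω), ∀ (u : Vec N) (ξ : Mat N d),
      ((a * ‖ξ‖ + c x : ℝ) : EReal) ≤ L x u ξ) {u₀ : W11 Ω N} (hu₀ : energy L u₀ ≠ ⊤)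
    (hconv : ∀ᵐ x ∂(volume.restrict Ω),
      ExtStrictConvex fun p : Vec N × Mat N d => L x p.1 p.2) {u v : W11 Ω N}
    (hu : IsMinimizer (energy L) (affineClass u₀) u)
    (hv : IsMinimizer (energy L) (affineClass u₀) v) : u = v := by
  have hfin : ∀ {w}, IsMinimizer (energy L) (affineClass u₀) w → energy L w < ⊤ := fun hw =>
    (hw.2 u₀ (self_mem_affineClass u₀)).trans_lt (lt_top_iff_ne_top.2 hu₀)
  obtain ⟨f, hfi, hf, hfe, -⟩ := exists_density_of_energy_lt_top hL ha hc hlower (hfin hu)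
  obtain ⟨g, hgi, hg, hge, -⟩ := exists_density_of_energy_lt_top hL ha hc hlower (hfin hv)
  set w : W11 Ω N := (1 / 2 : ℝ) • u + (1 - 1 / 2 : ℝ) • v with hw
  have hwmem : w ∈ affineClass u₀ :=
    convex_affineClass u₀ hu.1 hv.1 (by norm_num) (by norm_num) (by norm_num)
  -- Pointwise midpoint convexity, with equality only where the functions agree. Minimality forces
  -- equality almost everywhere.
  have hkey : ∀ᵐ x ∂(volume.restrict Ω),
      L x (fn w x) (grad w x) ≤ ((1 / 2 * f x + (1 - 1 / 2) * g x : ℝ) : EReal) ∧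
      (L x (fn w x) (grad w x) = ((1 / 2 * f x + (1 - 1 / 2) * g x : ℝ) : EReal) →
        fn u x = fn v x) := by
    filter_upwards [fn_combo (1 / 2) (1 - 1 / 2) u v, grad_combo (1 / 2) (1 - 1 / 2) u v, hf, hg,
      hconv] with x h1 h2 h3 h4 h5
    by_cases heq : ((fn u x, grad u x) : Vec N × Mat N d) = (fn v x, grad v x)
    · have h6 := congrArg Prod.fst heq
      have h7 := congrArg Prod.snd heq
      simp only at h6 h7
      refine ⟨le_of_eq ?_, fun _ => h6⟩
      have h8 : f x = g x := by
        rw [h6, h7, h4] at h3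
        exact (EReal.coe_eq_coe_iff.1 h3).symm
      rw [h1, h2, h6, h7, ← add_smul, ← add_smul, h8, ← add_mul]
      norm_num
      exact h4
    · have h6 := h5 _ _ heq (by simp only [h3]; exact EReal.coe_ne_top _)
        (by simp only [h4]; exact EReal.coe_ne_top _) (1 / 2) (by norm_num) (by norm_num)
      have h7 : L x (fn w x) (grad w x)
          < ((1 / 2 * f x + (1 - 1 / 2) * g x : ℝ) : EReal) := by
        rw [h1, h2, EReal.coe_add, EReal.coe_mul, EReal.coe_mul, ← h3, ← h4]
        exact h6
      exact ⟨h7.le, fun h => absurd h h7.ne⟩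
  have hmid : Integrable (fun x => 1 / 2 * f x + (1 - 1 / 2) * g x) (volume.restrict Ω) :=
    (hfi.const_mul _).add (hgi.const_mul _)
  have hwlt : energy L w < ⊤ := by
    refine (extIntegral_mono (hkey.mono fun x hx => hx.1)).trans_lt ?_
    rw [extIntegral_coe hmid]
    exact EReal.coe_lt_top _
  obtain ⟨h, hhi, hh, hhe, -⟩ := exists_density_of_energy_lt_top hL ha hc hlower hwlt
  have hfh : ∫ x in Ω, f x ≤ ∫ x in Ω, h x := by
    have := hu.2 w hwmem
    rwa [hfe, hhe, EReal.coe_le_coe_iff] at this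
  have hgh : ∫ x in Ω, g x ≤ ∫ x in Ω, h x := by
    have := hv.2 w hwmem
    rwa [hge, hhe, EReal.coe_le_coe_iff] at this
  have hnn : 0 ≤ᵐ[volume.restrict Ω] fun x => 1 / 2 * f x + (1 - 1 / 2) * g x - h x := by
    filter_upwards [hkey, hh] with x h1 h2
    have h3 := h1.1
    rw [h2, EReal.coe_le_coe_iff] at h3
    exact sub_nonneg.2 h3
  have hzero : ∫ x in Ω, (1 / 2 * f x + (1 - 1 / 2) * g x - h x) = 0 := by
    refine le_antisymm ?_ (integral_nonneg_of_ae hnn)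
    rw [integral_sub hmid hhi, integral_add (hfi.const_mul _) (hgi.const_mul _),
      integral_const_mul, integral_const_mul]
    linarith
  have hae := (integral_eq_zero_iff_of_nonneg_ae hnn (hmid.sub hhi)).1 hzero
  refine eq_of_fn_eq hΩ (Lp.ext ?_)
  filter_upwards [hae, hkey, hh] with x h1 h2 h3
  refine h2.2 ?_
  rw [h3, EReal.coe_eq_coe_iff]
  simp only [Pi.zero_apply] at h1
  linarith

end Uniqueness

/-! ### Compactness in the affine class and convergence of derivatives -/

section Compactness

variable {d N : ℕ} {Ω : Set (Vec d)}

/-- Sequences in `u₀ + W_0^{1,1}` with bounded derivatives have subsequences converging in `L¹` and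
almost everywhere. -/
theorem exists_subseq_tendsto_of_mem_affineClass (hd : 1 ≤ d) (hΩ : IsOpen Ω)
    (hb : Bornology.IsBounded Ω) {u₀ : W11 Ω N} {u : ℕ → W11 Ω N}
    (hu : ∀ n, u n ∈ affineClass u₀) {G : ℝ} (hG : ∀ n i, ‖weakD (u n) i‖ ≤ G) :
    ∃ f : LOne Ω N, ∃ ψ : ℕ → ℕ, StrictMono ψ ∧ Tendsto (fun n => fn (u (ψ n))) atTop (𝓝 f) ∧
      ∀ᵐ x ∂(volume.restrict Ω), Tendsto (fun n => fn (u (ψ n)) x) atTop (𝓝 (f x)) := by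
  obtain ⟨f, ψ, hψ, hf⟩ := exists_subseq_tendsto_of_bounded hd hΩ hb
    (p := fun n => (u n).1 - u₀.1) (fun n => mem_affineClass_iff.1 (hu n))
    (M := ∑ i, (G + ‖weakD u₀ i‖)) (fun n => Finset.sum_le_sum fun i _ =>
      (norm_sub_le (weakD (u n) i) (weakD u₀ i)).trans (add_le_add_left (hG n i) _))
  have hf' : Tendsto (fun n => fn (u (ψ n))) atTop (𝓝 (f + fn u₀)) := by
    refine (hf.add_const (fn u₀)).congr fun n => ?_
    exact sub_add_cancel (fn (u (ψ n))) (fn u₀)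
  obtain ⟨χ, hχ, hae⟩ := (tendstoInMeasure_of_tendsto_Lp hf').exists_seq_tendsto_ae
  exact ⟨f + fn u₀, ψ ∘ χ, hψ.comp hχ, hf'.comp hχ.tendsto_atTop, hae⟩

/-- The gradient space with an additional coordinate for the energy density. -/
abbrev GradEnergy (N d : ℕ) : Type := WithLp 2 (Mat N d × ℝ)

/-- Pairs of a Sobolev function and an energy density. -/
abbrev FnDensity (Ω : Set (Vec d)) (N : ℕ) : Type :=
  W11 Ω N × Lp ℝ 1 (volume.restrict Ω)

/-- The pair of the gradient and the energy density as a pointwise function. -/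
noncomputable def gradDensity (p : FnDensity Ω N) (x : Vec d) : GradEnergy N d :=
  WithLp.toLp 2 (grad p.1 x, p.2 x)

theorem density_combo (t s : ℝ) (p q : FnDensity Ω N) :
    (t • p + s • q).2 =ᵐ[volume.restrict Ω] fun x => t * p.2 x + s * q.2 x := by
  filter_upwards [Lp.coeFn_add (t • p.2) (s • q.2), Lp.coeFn_smul t p.2,
    Lp.coeFn_smul s q.2] with x h1 h2 h3
  change (t • p.2 + s • q.2 : Lp ℝ 1 (volume.restrict Ω)) x = _
  rw [h1, Pi.add_apply, h2, h3]
  rfl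

theorem gradDensity_combo (t s : ℝ) (p q : FnDensity Ω N) :
    gradDensity (t • p + s • q) =ᵐ[volume.restrict Ω]
      fun x => t • gradDensity p x + s • gradDensity q x := by
  filter_upwards [grad_combo t s p.1 q.1, density_combo t s p q] with x h1 h2
  have h3 : grad (t • p + s • q).1 x = t • grad p.1 x + s • grad q.1 x := h1
  unfold gradDensity
  rw [h2, h3]
  rfl

theorem integrable_gradDensity (p : FnDensity Ω N) :
    Integrable (gradDensity p) (volume.restrict Ω) :=
  (WithLp.prodContinuousLinearEquiv 2 ℝ (Mat N d) ℝ).symm.toContinuousLinearMap.integrable_comp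
    ((integrable_grad p.1).prodMk (L1.integrable_coeFn p.2))

theorem integral_norm_gradDensity_le (p : FnDensity Ω N) :
    ∫ x in Ω, ‖gradDensity p x‖ ≤ ∑ i, ‖weakD p.1 i‖ + ‖p.2‖ := by
  have h1 : ∀ x, ‖gradDensity p x‖ ≤ ∑ i, ‖weakD p.1 i x‖ + ‖p.2 x‖ := by
    intro x
    refine le_trans ?_ (add_le_add_left (norm_grad_le_sum p.1 x) _)
    refine le_of_sq_le_sq ?_ (by positivity)
    rw [WithLp.prod_norm_sq_eq_of_L2]
    change ‖grad p.1 x‖ ^ 2 + ‖p.2 x‖ ^ 2 ≤ _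
    nlinarith [norm_nonneg (grad p.1 x), norm_nonneg (p.2 x)]
  have hi : ∀ i ∈ (Finset.univ : Finset (Fin d)),
      Integrable (fun x => ‖weakD p.1 i x‖) (volume.restrict Ω) :=
    fun i _ => (L1.integrable_coeFn _).norm
  refine (integral_mono (integrable_gradDensity p).norm
    ((integrable_finsetSum _ hi).add (L1.integrable_coeFn p.2).norm) h1).trans_eq ?_
  rw [integral_add' (integrable_finsetSum _ hi) (L1.integrable_coeFn p.2).norm,
    integral_finsetSum _ hi]
  simp only [L1.norm_eq_integral_norm]

/-- The underlying function as a linear map. -/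
noncomputable def fnLM (Ω : Set (Vec d)) (N : ℕ) : FnDensity Ω N →ₗ[ℝ] LOne Ω N :=
  LinearMap.fst ℝ _ _ ∘ₗ (W11 Ω N).subtype ∘ₗ LinearMap.fst ℝ _ _

/-- The weak partial derivative as a linear map. -/
noncomputable def weakDLM (Ω : Set (Vec d)) (N : ℕ) (i : Fin d) : FnDensity Ω N →ₗ[ℝ] LOne Ω N :=
  LinearMap.proj i ∘ₗ LinearMap.snd ℝ (LOne Ω N) (Fin d → LOne Ω N) ∘ₗ (W11 Ω N).subtype ∘ₗ
    LinearMap.fst ℝ _ _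

theorem fnLM_apply (p : FnDensity Ω N) : fnLM Ω N p = fn p.1 := rfl

theorem weakDLM_apply (i : Fin d) (p : FnDensity Ω N) : weakDLM Ω N i p = weakD p.1 i := rfl

/-- Used to pass equi-integrability, with the same modulus, to convex combinations. -/
theorem convex_setOf_setIntegral_norm_le {A : Set (Vec d)} (hA : A ⊆ Ω) (ε : ℝ) :
    Convex ℝ {f : LOne Ω N | ∫ x in A, ‖f x‖ ≤ ε} := by
  intro f hf g hg t s ht hs hts
  have hi : ∀ f : LOne Ω N, Integrable (fun x => ‖f x‖) (volume.restrict A) := fun f =>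
    (IntegrableOn.mono_set (L1.integrable_coeFn f) hA).norm
  have h1 : ∀ᵐ x ∂(volume.restrict A),
      ‖(t • f + s • g : LOne Ω N) x‖ ≤ t * ‖f x‖ + s * ‖g x‖ := by
    refine ae_mono (Measure.restrict_mono_set _ hA) ?_
    filter_upwards [Lp.coeFn_add (t • f) (s • g), Lp.coeFn_smul t f, Lp.coeFn_smul s g] with
      x h1 h2 h3
    rw [h1, Pi.add_apply, h2, h3]
    refine (norm_add_le _ _).trans_eq ?_
    rw [Pi.smul_apply, Pi.smul_apply, norm_smul, norm_smul, Real.norm_of_nonneg ht,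
      Real.norm_of_nonneg hs]
  have h2 := integral_mono_ae (hi _) (((hi f).const_mul t).add ((hi g).const_mul s)) h1
  have h3 : ∫ x in A, (t * ‖f x‖ + s * ‖g x‖) 
      = (t * ∫ x in A, ‖f x‖) + s * ∫ x in A, ‖g x‖ := by
    rw [integral_add ((hi f).const_mul t) ((hi g).const_mul s), integral_const_mul,
      integral_const_mul]
  have h4 := mul_le_mul_of_nonneg_left hf.out ht
  have h5 := mul_le_mul_of_nonneg_left hg.out hs
  refine h2.trans (h3.le.trans ?_)
  calc _ ≤ t * ε + s * ε := add_le_add h4 h5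
    _ = ε := by rw [← add_mul, hts, one_mul]

/-- A sequence converging almost everywhere, with equi-integrable norms, converges in `L¹`. -/
theorem tendsto_of_ae_of_equiIntegrable [IsFiniteMeasure (volume.restrict Ω)]
    (hΩ : MeasurableSet Ω) {f : ℕ → LOne Ω N} {M : ℝ} (hM : ∀ n, ‖f n‖ ≤ M)
    (heq : ∀ ε > 0, ∃ δ > 0, ∀ n, ∀ A ⊆ Ω, MeasurableSet A → volume A < ENNReal.ofReal δ →
      ∫ x in A, ‖f n x‖ ≤ ε)
    {g : Vec d → Vec N}
    (hae : ∀ᵐ x ∂(volume.restrict Ω), Tendsto (fun n => f n x) atTop (𝓝 (g x))) :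
    ∃ G : LOne Ω N, G =ᵐ[volume.restrict Ω] g ∧ Tendsto f atTop (𝓝 G) := by
  have hfm : ∀ n, AEStronglyMeasurable (f n) (volume.restrict Ω) := fun n =>
    Lp.aestronglyMeasurable _
  have hg : MemLp g 1 (volume.restrict Ω) := by
    refine ⟨aestronglyMeasurable_of_tendsto_ae _ hfm hae, ?_⟩
    refine (Lp.eLpNorm_le_of_ae_tendsto (C := ENNReal.ofReal M) (Eventually.of_forall fun n => ?_)
      hfm hae).trans_lt ENNReal.ofReal_lt_top
    rw [eLpNorm_one_eq_lintegral_enorm, lintegral_enorm_coeFn]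
    exact ENNReal.ofReal_le_ofReal (hM n)
  refine ⟨hg.toLp g, hg.coeFn_toLp, ?_⟩
  rw [Lp.tendsto_Lp_iff_tendsto_eLpNorm]
  refine tendsto_Lp_finite_of_tendsto_ae le_rfl ENNReal.one_ne_top hfm hg ?_ hae
  intro ε hε
  obtain ⟨δ, hδ, h⟩ := heq ε hε
  -- Halving turns the non-strict measure bound of uniform integrability into the strict one of
  -- `heq`.
  refine ⟨δ / 2, half_pos hδ, fun n s hs hμs => ?_⟩
  rw [eLpNorm_indicator_eq_eLpNorm_restrict hs, eLpNorm_one_eq_lintegral_enorm,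
    Measure.restrict_restrict hs]
  rw [Measure.restrict_apply hs] at hμs
  have hi : Integrable (f n) (volume.restrict (s ∩ Ω)) :=
    IntegrableOn.mono_set (L1.integrable_coeFn (f n)) inter_subset_right
  rw [← ofReal_integral_norm_eq_lintegral_enorm hi]
  refine ENNReal.ofReal_le_ofReal (h n _ inter_subset_right (hs.inter hΩ) (hμs.trans_lt ?_))
  exact (ENNReal.ofReal_lt_ofReal_iff hδ).2 (half_lt_self hδ)

end Compactness

/-! ### Fatou's lemma with an integrable minorant -/

section Fatou

/-- Fatou's lemma for sequences bounded below by an integrable function. -/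
theorem integrable_and_integral_le_of_ae_tendsto {X : Type*} [MeasurableSpace X] {μ : Measure X}
    {k : ℕ → X → ℝ} {c η : X → ℝ} (hk : ∀ n, Integrable (k n) μ) (hc : Integrable c μ)
    (hck : ∀ n, c ≤ᵐ[μ] k n) (hae : ∀ᵐ x ∂μ, Tendsto (fun n => k n x) atTop (𝓝 (η x))) {I : ℝ}
    (hI : ∀ ε > 0, ∀ᶠ n in atTop, ∫ x, k n x ∂μ ≤ I + ε) :
    Integrable η μ ∧ ∫ x, η x ∂μ ≤ I := by
  have hηm : AEStronglyMeasurable η μ :=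
    aestronglyMeasurable_of_tendsto_ae _ (fun n => (hk n).1) hae
  have hcη : 0 ≤ᵐ[μ] fun x => η x - c x := by
    filter_upwards [hae, ae_all_iff.2 hck] with x h1 h2
    exact sub_nonneg.2 (ge_of_tendsto' h1 h2)
  have hfat : ∀ ε > 0, ∫⁻ x, ENNReal.ofReal (η x - c x) ∂μ
      ≤ ENNReal.ofReal (I + ε - ∫ x, c x ∂μ) := by
    intro ε hε
    have h1 : ∫⁻ x, ENNReal.ofReal (η x - c x) ∂μ
        = ∫⁻ x, liminf (fun n => ENNReal.ofReal (k n x - c x)) atTop ∂μ := by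
      refine lintegral_congr_ae ?_
      filter_upwards [hae] with x hx
      exact ((ENNReal.continuous_ofReal.tendsto _).comp (hx.sub_const (c x))).liminf_eq.symm
    rw [h1]
    refine (lintegral_liminf_le' fun n => ?_).trans ?_
    · exact ((hk n).sub hc).1.aemeasurable.ennreal_ofReal
    · refine liminf_le_of_frequently_le' (Eventually.frequently ?_)
      filter_upwards [hI ε hε] with n hn
      have hi : Integrable (fun x => k n x - c x) μ := (hk n).sub hc
      rw [← ofReal_integral_eq_lintegral_ofReal hi
        ((hck n).mono fun x hx => sub_nonneg.2 hx), integral_sub (hk n) hc]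
      exact ENNReal.ofReal_le_ofReal (by linarith)
  have hηc : Integrable (fun x => η x - c x) μ := by
    refine ⟨hηm.sub hc.1, ?_⟩
    rw [hasFiniteIntegral_iff_ofReal hcη]
    exact (hfat 1 one_pos).trans_lt ENNReal.ofReal_lt_top
  have hη : Integrable η μ := (hηc.add hc).congr (Eventually.of_forall fun x => by simp)
  refine ⟨hη, le_of_forall_pos_le_add fun ε hε => ?_⟩
  have h1 := hfat ε hε
  rw [← ofReal_integral_eq_lintegral_ofReal hηc hcη] at h1
  have h2 : 0 ≤ I + ε - ∫ x, c x ∂μ := by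
    obtain ⟨n, hn⟩ := (hI ε hε).exists
    have := integral_mono_ae hc (hk n) (hck n)
    linarith
  have h3 := (ENNReal.ofReal_le_ofReal_iff h2).1 h1
  rw [integral_sub hη hc] at h3
  linarith

end Fatou

/-! ### Lower semicontinuity of the energy -/

section LowerSemicontinuity

variable {d N : ℕ} {Ω : Set (Vec d)}

/-- The device by which norm bounds, equi-integrability, boundary values and energy bounds are
inherited by forward convex combinations. -/
theorem forall_convexHull_of_convex {P : Type*} [AddCommGroup P] [Module ℝ P] {z : ℕ → P}
    {S : Set P} (hS : Convex ℝ S) {n₀ : ℕ} (hz : ∀ m ≥ n₀, z m ∈ S) {n : ℕ} (hn : n₀ ≤ n) {p : P}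
    (hp : p ∈ convexHull ℝ (z '' Ici n)) : p ∈ S := by
  refine convexHull_min ?_ hS hp
  rintro _ ⟨m, hm, rfl⟩
  exact hz m (hn.trans hm)

theorem map_mem_of_mem_convexHull {P Q : Type*} [AddCommGroup P] [Module ℝ P] [AddCommGroup Q]
    [Module ℝ Q] (T : P →ₗ[ℝ] Q) {z : ℕ → P} {S : Set Q} (hS : Convex ℝ S) {n₀ : ℕ}
    (hz : ∀ m ≥ n₀, T (z m) ∈ S) {n : ℕ} (hn : n₀ ≤ n) {p : P}
    (hp : p ∈ convexHull ℝ (z '' Ici n)) : T p ∈ S :=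
  forall_convexHull_of_convex (hS.linear_preimage T) hz hn hp

theorem integral_norm_le_of_le {X : Type*} [MeasurableSpace X] {μ : Measure X} {h c : X → ℝ}
    (hh : Integrable h μ) (hc : Integrable c μ) (hch : c ≤ᵐ[μ] h) :
    ∫ x, ‖h x‖ ∂μ ≤ (∫ x, h x ∂μ) + 2 * ∫ x, ‖c x‖ ∂μ := by
  rw [← integral_const_mul, ← integral_add hh (hc.norm.const_mul 2)]
  refine integral_mono_ae hh.norm (hh.add (hc.norm.const_mul 2)) ?_
  filter_upwards [hch] with x hx
  change ‖h x‖ ≤ h x + 2 * ‖c x‖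
  rw [Real.norm_eq_abs, Real.norm_eq_abs]
  have h1 := neg_abs_le (c x)
  have h2 := abs_nonneg (c x)
  refine abs_le.2 ⟨by linarith, by linarith⟩

/-- Forward convex combinations of pairs of Sobolev functions and energy densities are pointwise
forward convex combinations. -/
theorem ae_mem_convexHull_of_mem_convexHull {z : ℕ → FnDensity Ω N} {n : ℕ}
    {p : FnDensity Ω N} (hp : p ∈ convexHull ℝ (z '' Ici n)) :
    ∀ᵐ x ∂(volume.restrict Ω), (grad p.1 x, p.2 x) ∈
      convexHull ℝ ((fun m => (grad (z m).1 x, (z m).2 x)) '' Ici n) := by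
  refine forall_convexHull_of_convex (S := {p : FnDensity Ω N | ∀ᵐ x ∂(volume.restrict Ω),
    (grad p.1 x, p.2 x) ∈ convexHull ℝ ((fun m => (grad (z m).1 x, (z m).2 x)) '' Ici n)})
    ?_ ?_ le_rfl hp
  · intro p hp q hq t s ht hs hts
    filter_upwards [hp.out, hq.out, grad_combo t s p.1 q.1, density_combo t s p q] with
      x h1 h2 h3 h4
    have h5 : grad (t • p + s • q).1 x = t • grad p.1 x + s • grad q.1 x := h3
    rw [h5, h4]
    exact convex_convexHull ℝ _ h1 h2 ht hs hts
  · intro m hm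
    change ∀ᵐ x ∂(volume.restrict Ω), _
    exact Eventually.of_forall fun x => subset_convexHull ℝ _
      (mem_image_of_mem (fun m => (grad (z m).1 x, (z m).2 x)) (mem_Ici.2 hm))

theorem convex_setOf_le_density (c : Vec d → ℝ) :
    Convex ℝ {q : FnDensity Ω N | c ≤ᵐ[volume.restrict Ω] q.2} := by
  intro q hq r hr t s ht hs hts
  filter_upwards [hq.out, hr.out, density_combo t s q r] with x h1 h2 h3
  rw [h3]
  calc c x = t * c x + s * c x := by rw [← add_mul, hts, one_mul]
    _ ≤ _ := add_le_add (mul_le_mul_of_nonneg_left h1 ht) (mul_le_mul_of_nonneg_left h2 hs)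

theorem convex_setOf_integral_density_le (b : ℝ) :
    Convex ℝ {q : FnDensity Ω N | ∫ x in Ω, q.2 x ≤ b} := by
  intro q hq r hr t s ht hs hts
  change ∫ x in Ω, (t • q + s • r).2 x ≤ b
  rw [integral_congr_ae (density_combo t s q r),
    integral_add ((L1.integrable_coeFn q.2).const_mul t)
      ((L1.integrable_coeFn r.2).const_mul s), integral_const_mul, integral_const_mul]
  calc _ ≤ t * b + s * b := add_le_add
        (mul_le_mul_of_nonneg_left hq.out ht) (mul_le_mul_of_nonneg_left hr.out hs)
    _ = b := by rw [← add_mul, hts, one_mul]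

theorem mem_affineClass_of_tendsto {u₀ U : W11 Ω N} {w : ℕ → W11 Ω N}
    (hw : ∀ n, w n ∈ affineClass u₀) (h : Tendsto (fun n => (w n).1) atTop (𝓝 U.1)) :
    U ∈ affineClass u₀ := by
  rw [mem_affineClass_iff]
  have h1 : Tendsto (fun n => (w n).1 - u₀.1) atTop (𝓝 (U.1 - u₀.1)) := h.sub_const u₀.1
  exact (Submodule.isClosed_topologicalClosure (testSubmodule Ω N)).mem_of_tendsto h1
    (Eventually.of_forall fun n => mem_affineClass_iff.1 (hw n))

set_option maxHeartbeats 400000 in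
/-- Lower semicontinuity of the energy along sequences whose functions converge strongly and whose
derivatives are bounded and equi-integrable. -/
theorem exists_mem_affineClass_energy_le (hΩ : IsOpen Ω) (hb : Bornology.IsBounded Ω)
    {L : Vec d → Vec N → Mat N d → EReal} {a : ℝ} {c : Vec d → ℝ}
    (hcont : ∀ᵐ x ∂(volume.restrict Ω), Continuous fun p : Vec N × Mat N d => L x p.1 p.2)
    (ha : 0 < a) (hc : IntegrableOn c Ω)
    (hlower : ∀ᵐ x ∂(volume.restrict Ω), ∀ (u : Vec N) (ξ : Mat N d),
      ((a * ‖ξ‖ + c x : ℝ) : EReal) ≤ L x u ξ)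
    (hconv : ∀ᵐ x ∂(volume.restrict Ω), ∀ u : Vec N, ExtConvex (L x u))
    {u₀ : W11 Ω N} {u : ℕ → W11 Ω N} (hu : ∀ n, u n ∈ affineClass u₀)
    {h : ℕ → Vec d → ℝ} (hint : ∀ n, Integrable (h n) (volume.restrict Ω))
    (hle : ∀ n, ∀ᵐ x ∂(volume.restrict Ω), L x (fn (u n) x) (grad (u n) x) ≤ h n x)
    {I : ℝ} (hI : Tendsto (fun n => ∫ x in Ω, h n x) atTop (𝓝 I))
    {G : ℝ} (hG : ∀ n i, ‖weakD (u n) i‖ ≤ G) (hequi : TopOrderEquiIntegrable u)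
    {f : LOne Ω N} (hf : Tendsto (fun n => fn (u n)) atTop (𝓝 f))
    (hfae : ∀ᵐ x ∂(volume.restrict Ω), Tendsto (fun n => fn (u n) x) atTop (𝓝 (f x))) :
    ∃ U ∈ affineClass u₀, energy L U ≤ (I : EReal) := by
  have hfin : IsFiniteMeasure (volume.restrict Ω) :=
    ⟨by rw [Measure.restrict_apply_univ]; exact hb.measure_lt_top⟩
  have hch : ∀ n, c ≤ᵐ[volume.restrict Ω] h n := by
    intro n
    filter_upwards [hle n, hlower] with x h1 h2
    have h3 := EReal.coe_le_coe_iff.1 ((h2 _ _).trans h1)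
    have : 0 ≤ a * ‖grad (u n) x‖ := by positivity
    linarith
  obtain ⟨B, hB⟩ := hI.bddAbove_range
  set H : ℝ := B + 2 * ∫ x in Ω, ‖c x‖ with hH
  let z : ℕ → FnDensity Ω N := fun m => (u m, (hint m).toL1 (h m))
  have hz2 : ∀ m, (z m).2 =ᵐ[volume.restrict Ω] h m := fun m => (hint m).coeFn_toL1
  have hzH : ∀ m, ‖(z m).2‖ ≤ H := by
    intro m
    have h1 : ‖(z m).2‖ = ∫ x in Ω, ‖h m x‖ := by
      rw [L1.norm_eq_integral_norm]
      refine integral_congr_ae ?_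
      filter_upwards [hz2 m] with x hx
      rw [hx]
    rw [h1]
    refine (integral_norm_le_of_le (hint m) hc (hch m)).trans ?_
    have : ∫ x in Ω, h m x ≤ B := hB (mem_range_self m)
    linarith
  set C : ℕ → Set (FnDensity Ω N) := fun n => convexHull ℝ (z '' Ici n) with hC
  have hCG : ∀ n, ∀ p ∈ C n, ∀ i, ‖weakD p.1 i‖ ≤ G := by
    intro n p hp i
    have h1 := map_mem_of_mem_convexHull (weakDLM Ω N i) (convex_closedBall (0 : LOne Ω N) G)
      (z := z) (n₀ := 0) (fun m _ => by
        rw [weakDLM_apply, mem_closedBall_zero_iff]; exact hG m i) (Nat.zero_le n) hp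
    rwa [weakDLM_apply, mem_closedBall_zero_iff] at h1
  have hCH : ∀ p ∈ C 0, ‖p.2‖ ≤ H := by
    intro p hp
    have h1 := map_mem_of_mem_convexHull (LinearMap.snd ℝ (W11 Ω N) _)
      (convex_closedBall (0 : Lp ℝ 1 (volume.restrict Ω)) H)
      (z := z) (n₀ := 0) (fun m _ => by
        rw [LinearMap.snd_apply, mem_closedBall_zero_iff]; exact hzH m) le_rfl hp
    rwa [LinearMap.snd_apply, mem_closedBall_zero_iff] at h1
  -- Gradient and density are selected with the same weights, so that the pairs remain convex
  -- combinations of epigraph points. The `L²` product structure makes their target an inner product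
  -- space, as `areaFn` requires.
  obtain ⟨p, hpC, F, hF⟩ := exists_ae_tendsto_of_antitone_convex
    (μ := volume.restrict Ω) (gradDensity (Ω := Ω) (N := N)) integrable_gradDensity
    (gradDensity_combo _ _) (C := C)
    (fun n m hnm => convexHull_mono (image_mono (Ici_subset_Ici.2 hnm)))
    (fun n => convex_convexHull ℝ _)
    (fun n => ⟨z n, subset_convexHull ℝ _ ⟨n, self_mem_Ici, rfl⟩⟩)
    (M := d * G + H) (fun q hq => by
      refine (integral_norm_gradDensity_le q).trans (add_le_add ?_ (hCH q hq))
      refine (Finset.sum_le_card_nsmul _ _ G fun i _ => hCG 0 q hq i).trans_eq ?_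
      simp)
  have hgrad : ∀ᵐ x ∂(volume.restrict Ω),
      Tendsto (fun n => (grad (p n).1 x, (p n).2 x)) atTop (𝓝 ((F x).fst, (F x).snd)) := by
    filter_upwards [hF] with x hx
    exact ((WithLp.prod_continuous_ofLp 2 (Mat N d) ℝ).tendsto (F x)).comp hx
  -- convergence of the functions and of the derivatives in `L¹`
  have hfn : Tendsto (fun n => fn (p n).1) atTop (𝓝 f) := by
    refine Metric.tendsto_atTop.2 fun ε hε => ?_
    obtain ⟨n₀, hn₀⟩ := Metric.tendsto_atTop.1 hf ε hε
    refine ⟨n₀, fun n hn => ?_⟩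
    have h1 := map_mem_of_mem_convexHull (fnLM Ω N) (convex_ball f ε) (z := z)
      (fun m hm => by rw [fnLM_apply, Metric.mem_ball]; exact hn₀ m hm) hn (hpC n)
    rwa [fnLM_apply, Metric.mem_ball] at h1
  have hDlim : ∀ i, ∃ g : LOne Ω N,
      (∀ᵐ x ∂(volume.restrict Ω), ∀ j, g x j = (F x).fst (j, i)) ∧
      Tendsto (fun n => weakD (p n).1 i) atTop (𝓝 g) := by
    intro i
    -- Vitali's theorem; the modulus `δ` of the original sequence also serves for the combinations.
    obtain ⟨g, hg, hlim⟩ := tendsto_of_ae_of_equiIntegrable (f := fun n => weakD (p n).1 i)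
      hΩ.measurableSet (fun n => hCG n _ (hpC n) i) (by
        intro ε hε
        obtain ⟨δ, hδ, hδ'⟩ := hequi
        refine ⟨δ ε, hδ ε hε, fun n A hA hAm hAδ => ?_⟩
        have h1 : ∀ m ≥ 0, weakDLM Ω N i (z m) ∈ {f : LOne Ω N | ∫ x in A, ‖f x‖ ≤ ε} := by
          intro m _
          rw [weakDLM_apply]
          refine le_trans ?_ (hδ' m ε hε A hA hAm hAδ).le
          exact Finset.single_le_sum (f := fun i => ∫ x in A, ‖weakD (u m) i x‖)
            (fun _ _ => integral_nonneg fun _ => norm_nonneg _) (Finset.mem_univ i)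
        have h2 := map_mem_of_mem_convexHull (weakDLM Ω N i)
          (convex_setOf_setIntegral_norm_le hA ε) h1 (Nat.zero_le n) (hpC n)
        rwa [weakDLM_apply] at h2)
      (g := fun x => WithLp.toLp 2 fun j => (F x).fst (j, i)) (by
        filter_upwards [hgrad] with x hx
        have hx1 : Tendsto (fun n => grad (p n).1 x) atTop (𝓝 (F x).fst) := hx.fst_nhds
        have hcont : Continuous fun ξ : Mat N d =>
            (WithLp.toLp 2 fun j => ξ (j, i) : Vec N) := by fun_prop
        exact (hcont.tendsto _).comp hx1)
    refine ⟨g, ?_, hlim⟩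
    filter_upwards [hg] with x hx j
    rw [hx]
  choose g hg hglim using hDlim
  have hlim : Tendsto (fun n => (p n).1.1) atTop (𝓝 (f, g)) :=
    hfn.prodMk_nhds (tendsto_pi_nhds.2 hglim)
  have hmem : (f, g) ∈ W11 Ω N :=
    isClosed_W11.mem_of_tendsto hlim (Eventually.of_forall fun n => (p n).1.2)
  set U : W11 Ω N := ⟨(f, g), hmem⟩ with hU
  have hUmem : U ∈ affineClass u₀ := by
    refine mem_affineClass_of_tendsto (w := fun n => (p n).1) (fun n => ?_) hlim
    have h1 := map_mem_of_mem_convexHull (LinearMap.fst ℝ (W11 Ω N) _)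
      (convex_affineClass u₀) (z := z) (n₀ := 0) (fun m _ => by
        rw [LinearMap.fst_apply]; exact hu m) (Nat.zero_le n) (hpC n)
    rwa [LinearMap.fst_apply] at h1
  have hUgrad : ∀ᵐ x ∂(volume.restrict Ω), grad U x = (F x).fst := by
    filter_upwards [ae_all_iff.2 hg] with x hx
    ext ⟨j, i⟩
    exact hx i j
  -- the limit energy density
  obtain ⟨hηint, hηI⟩ := integrable_and_integral_le_of_ae_tendsto (μ := volume.restrict Ω)
    (k := fun n => (p n).2) (c := c) (η := fun x => (F x).snd) (I := I)
    (fun n => L1.integrable_coeFn _) hc (fun n => by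
      refine forall_convexHull_of_convex (convex_setOf_le_density c) (z := z) (n₀ := 0)
        (fun m _ => ?_) (Nat.zero_le n) (hpC n)
      change c ≤ᵐ[volume.restrict Ω] (z m).2
      filter_upwards [hz2 m, hch m] with x h1 h2
      rw [h1]
      exact h2)
    (by filter_upwards [hgrad] with x hx using hx.snd_nhds)
    (by
      intro ε hε
      obtain ⟨n₀, hn₀⟩ := eventually_atTop.1 (hI.eventually_le_const (lt_add_of_pos_right I hε))
      filter_upwards [eventually_ge_atTop n₀] with n hn
      refine forall_convexHull_of_convex (convex_setOf_integral_density_le (I + ε)) (z := z)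
        (fun m hm => ?_) hn (hpC n)
      change ∫ x in Ω, (z m).2 x ≤ I + ε
      rw [integral_congr_ae (hz2 m)]
      exact hn₀ m hm)
  refine ⟨U, hUmem, ?_⟩
  have hpt : (fun x => L x (fn U x) (grad U x)) ≤ᵐ[volume.restrict Ω]
      fun x => ((F x).snd : EReal) := by
    filter_upwards [hcont, hlower, hconv, hfae, hgrad, hUgrad, ae_all_iff.2 hle,
      ae_all_iff.2 hz2, ae_all_iff.2 fun n => ae_mem_convexHull_of_mem_convexHull (hpC n)]
      with x h1 h2 h3 h4 h5 h6 h7 h8 h9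
    rw [h6]
    -- At fixed `x` the first argument runs along the original sequence `u m`; only gradients and
    -- densities are convexly combined.
    exact le_of_tendsto_convexHull h1 h3 ha h2 h4
      (z := fun m => (grad (z m).1 x, (z m).2 x)) (fun m => by
        simp only [h8 m]
        exact h7 m) h9 h5
  refine (extIntegral_mono hpt).trans ?_
  rw [extIntegral_coe hηint]
  exact EReal.coe_le_coe_iff.2 hηI

end LowerSemicontinuity

/-! ### Existence of a minimizer -/

section Existence

variable {d N : ℕ} {Ω : Set (Vec d)} {L : Vec d → Vec N → Mat N d → EReal} {a : ℝ} {c : Vec d → ℝ}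

theorem TopOrderEquiIntegrable.comp {u : ℕ → W11 Ω N} (hu : TopOrderEquiIntegrable u)
    (ψ : ℕ → ℕ) : TopOrderEquiIntegrable fun n => u (ψ n) := by
  obtain ⟨δ, h1, h2⟩ := hu
  exact ⟨δ, h1, fun n => h2 (ψ n)⟩

theorem exists_isMinimizer_of_equiIntegrable (hd : 1 ≤ d) (hΩ : IsOpen Ω)
    (hb : Bornology.IsBounded Ω) (hL : IsCaratheodory Ω L) (ha : 0 < a) (hc : IntegrableOn c Ω)
    (hlower : ∀ᵐ x ∂(volume.restrict Ω), ∀ (u : Vec N) (ξ : Mat N d),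
      ((a * ‖ξ‖ + c x : ℝ) : EReal) ≤ L x u ξ) {u₀ : W11 Ω N} (hu₀ : energy L u₀ ≠ ⊤)
    (hconv : ∀ᵐ x ∂(volume.restrict Ω), ∀ u : Vec N, ExtConvex (L x u)) {u : ℕ → W11 Ω N}
    (hu : IsMinimizingSeq (energy L) (affineClass u₀) u) (hequi : TopOrderEquiIntegrable u) :
    ∃ U : W11 Ω N, IsMinimizer (energy L) (affineClass u₀) U := by
  obtain ⟨I, hI⟩ := exists_iInf_energy_eq_coe ha hc hlower hu₀
  have htend := hu.2
  rw [hI] at htend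
  -- The first terms may have infinite energy, hence no real density; they are dropped by the shift
  -- `n + n₀`.
  obtain ⟨n₀, hn₀⟩ := eventually_atTop.1 (htend.eventually_lt_const (EReal.coe_lt_top I))
  choose h hint heq hen hle using fun n => exists_density_of_energy_lt_top hL ha hc hlower
    (hn₀ (n + n₀) (Nat.le_add_left _ _))
  have hIlim : Tendsto (fun n => ∫ x in Ω, h n x) atTop (𝓝 I) := by
    refine EReal.tendsto_coe.1 ?_
    simp only [← hen]
    exact (tendsto_add_atTop_iff_nat n₀).2 htend
  obtain ⟨B, hB⟩ := hIlim.bddAbove_range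
  have hG : ∀ n i, ‖weakD (u (n + n₀)) i‖ ≤ (B - ∫ x in Ω, c x) / a := by
    intro n i
    refine (norm_weakD_le ha hc (hint n) (hle n) i).trans ?_
    have : ∫ x in Ω, h n x ≤ B := hB (mem_range_self n)
    gcongr
  obtain ⟨f, ψ, hψ, hf, hfae⟩ := exists_subseq_tendsto_of_mem_affineClass hd hΩ hb
    (fun n => hu.1 (n + n₀)) hG
  obtain ⟨U, hUmem, hU⟩ := exists_mem_affineClass_energy_le hΩ hb hL.cont ha hc hlower hconv
    (fun n => hu.1 (ψ n + n₀)) (fun n => hint (ψ n)) (fun n => (heq (ψ n)).mono fun x hx => hx.le)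
    (hIlim.comp hψ.tendsto_atTop) (fun n i => hG (ψ n) i)
    (hequi.comp fun n => ψ n + n₀) hf hfae
  exact ⟨U, hUmem, fun v hv => hU.trans (hI ▸ iInf₂_le v hv)⟩

end Existence

end SobolevMin

theorem theorem1p6 {d N : ℕ} (hd : 1 ≤ d) (Ω : Set (Vec d))
    (hΩ_open : IsOpen Ω) (hΩ_bdd : Bornology.IsBounded Ω) (hΩ_cone : ConeCondition Ω)
    (L : Vec d → Vec N → Mat N d → EReal) (hL : IsCaratheodory Ω L)
    (a : ℝ) (ha : 0 < a) (c : Vec d → ℝ) (hc : IntegrableOn c Ω)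
    (hlower : ∀ᵐ x ∂(volume.restrict Ω), ∀ (u : Vec N) (ξ : Mat N d),
      ((a * ‖ξ‖ + c x : ℝ) : EReal) ≤ L x u ξ)
    (u₀ : W11 Ω N) (hu₀_top : energy L u₀ ≠ ⊤) (hu₀_bot : energy L u₀ ≠ ⊥) :
    -- every minimizing sequence is bounded
    (∀ u : ℕ → W11 Ω N, IsMinimizingSeq (energy L) (affineClass u₀) u →
      ∃ M : ℝ, 0 < M ∧ ∀ n, sobolevNorm (u n) ≤ M) ∧
    -- existence of a minimizer
    ((∀ᵐ x ∂(volume.restrict Ω), ∀ u : Vec N, ExtConvex (L x u)) →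
      (∃ u : ℕ → W11 Ω N, IsMinimizingSeq (energy L) (affineClass u₀) u ∧
        TopOrderEquiIntegrable u) →
      ∃ u : W11 Ω N, IsMinimizer (energy L) (affineClass u₀) u) ∧
    -- uniqueness of the minimizer
    ((∀ᵐ x ∂(volume.restrict Ω),
        ExtStrictConvex fun p : Vec N × Mat N d => L x p.1 p.2) →
      ∀ u v : W11 Ω N, IsMinimizer (energy L) (affineClass u₀) u →
        IsMinimizer (energy L) (affineClass u₀) v → u = v) := by
  refine ⟨fun u hu => ?_, fun hconv ⟨u, hu, hequi⟩ => ?_, fun hconv u v hu hv => ?_⟩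
  · exact exists_sobolevNorm_le hd hΩ_open hΩ_bdd hL ha hc hlower hu₀_top hu
  · exact exists_isMinimizer_of_equiIntegrable hd hΩ_open hΩ_bdd hL ha hc hlower hu₀_top hconv hu
      hequi
  · exact IsMinimizer.eq_of_extStrictConvex hΩ_open hL ha hc hlower hu₀_top hconv hu hv
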